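/- **Conventions.** Ordinals are identified with the set of smaller ordinals, and $e(\xi)=-1+\omega^\xi$ (so $e(0)=0$ and $e(\xi)=\omega^\xi-1$ in the sense of left subtraction). For $\xi>0$ let $\ell(\xi)$ be the unique $\beta$ with $\xi=\alpha+\omega^\beta$ for some $\alpha$, and let $\ell(0)=0$. The *hyperexponentials* $\langle e^\zeta\rangle_{\zeta\in\mathsf{On}}$ are the pointwise least family of normal functions with $e^1=e$ and $e^{\alpha+\beta}=e^\alpha\circ e^\beta$ for all ordinals $\alpha,\beta$. Call a function on the ordinals *initial* if it maps initial segments to initial segments. The *hyperlogarithms* $\langle\ell^\xi\rangle_{\xi\in\mathsf{On}}$ are the family of initial functions with $\ell^1=\ell$ and $\ell^{\alpha+\beta}=\ell^\beta\circ\ell^\alpha$ for all $\alpha,\beta$ which is maximal at each stage: if $\langle g^\xi\rangle_{\xi\in\mathsf{On}}$ is another family of initial functions with $g^1=\ell$ and $g^{\alpha+\beta}=g^\beta\circ g^\alpha$, and $g^\eta=\ell^\eta$ for all $\eta<\xi$, then $g^\xi(\alpha)\le\ell^\xi(\alpha)$ for all $\alpha$. For an ordinal $\Theta$, let $\mathcal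 I_0$ be the topology on $\Theta$ whose open sets are the downward closed subsets, and for $\lambda>0$ let $\mathcal I_\lambda$ be the topology on $\Theta$ generated by the sets $\{\vartheta<\Theta:\alpha<\ell^\xi\vartheta\le\beta\}$ and $\{\vartheta<\Theta:\ell^\xi\vartheta\le\beta\}$ with $\alpha<\beta\le\Theta$ (respectively $\beta\le\Theta$) and $\xi<\lambda$ (the *Icard topologies*; $\mathcal I_1$ is the interval topology). Write $\Theta_\lambda$ for $\Theta$ equipped with $\mathcal I_\lambda$. A *$d$-map* is a continuous open map between topological spaces all of whose fibres $f^{-1}(y)$ are discrete subspaces. A $d$-map $f\colon\Theta_{1+\Lambda}\to\Xi_1$ is *$\Lambda$-reductive* if for all $\lambda<1+\Lambda$ every $\vartheta<\Theta$ has an $\mathcal I_\lambda$-neighbourhood $U$ such that, for all $\xi,\zeta\in U$, $\ell^\lambda\xi=\ell^\lambda\zeta$ implies $f(\xi)=f(\zeta)$. **Theorem.** For all countable ordinals $\Theta$ and $\Lambda$ there exists a $\Lambda$-reductive surjection $$r^\Theta_\Lambda\colon (e^{1+\Lambda}(\Theta)+1)_{1+\Lambda}\to(e(\Theta)+1)_1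 .$$ -/

import Mathlib

open Ordinal Set

universe u

noncomputable section

namespace Reductive

/-! ### Hyperexponentials -/

/-- The function `e ξ = -1 + ω ^ ξ`. -/
def expOne (ξ : Ordinal.{u}) : Ordinal.{u} := ω ^ ξ - 1

/-- The hyperexponential `e ^ ζ`. On additively indecomposable exponents, `e ^ (ω ^ γ)` is the
`γ`-th Veblen function over `e` (it is `e` for `γ = 0`, and for `γ > 0` it enumerates the common
fixed points of all `e ^ (ω ^ δ)` with `δ < γ`); in general, if
`ζ = ω ^ γ + ζ'` with `ω ^ γ` the leading term of the Cantor normal form,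
then `e ^ ζ = e ^ (ω ^ γ) ∘ e ^ ζ'`. The theorems `isHyperexpFamily_hyperexp` and
`hyperexp_le` below show that this is the pointwise least family of normal functions
with `e ^ 1 = e` and `e ^ (α + β) = e ^ α ∘ e ^ β`. -/
def hyperexp (ζ : Ordinal.{u}) : Ordinal.{u} → Ordinal.{u} :=
  if _h : ζ = 0 then id
  else veblenWith expOne (log ω ζ) ∘ hyperexp (ζ - ω ^ log ω ζ)
termination_by ζ
decreasing_by exact sub_omega0_opow_log_lt _h

/-! ### Hyperlogarithms -/

/-- The function `ℓ`: if `ξ = α + ω ^ β` then `ℓ ξ = β`, and `ℓ 0 = 0` (the infimum of the empty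
set). -/
def logOne (ξ : Ordinal.{u}) : Ordinal.{u} := sInf {β : Ordinal.{u} | ∃ α, ξ = α + ω ^ β}

/-- Given the functions `L δ = ℓ ^ (ω ^ δ)` for `δ < γ`, the function `ℓ ^ (ω ^ γ)`. If some `L δ`
moves `α` (necessarily down), the value at `α` is the value at the least `L δ α`, as required by
`ℓ ^ (ω ^ γ) = ℓ ^ (ω ^ γ) ∘ ℓ ^ (ω ^ δ)`; otherwise it is the largest value permitted by the
requirement that initial segments be mapped to initial segments. -/
def hyperlogStep (γ : Ordinal.{u}) (L : Set.Iio γ → Ordinal.{u} → Ordinal.{u})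
    (α : Ordinal.{u}) : Ordinal.{u} :=
  if _h : sInf (Set.range fun δ => L δ α) < α then
    hyperlogStep γ L (sInf (Set.range fun δ => L δ α))
  else ⨆ ζ : Set.Iio α, Order.succ (hyperlogStep γ L ζ.1)
termination_by α
decreasing_by
  · exact _h
  · exact ζ.2

/-- The hyperlogarithm `ℓ ^ (ω ^ γ)`. -/
def hyperlogPow (γ : Ordinal.{u}) : Ordinal.{u} → Ordinal.{u} :=
  if γ = 0 then logOne else hyperlogStep γ fun δ => hyperlogPow δ.1
termination_by γ
decreasing_by exact δ.2

/-- The hyperlogarithm `ℓ ^ ξ`: if `ξ = ω ^ γ + ξ'` with `ω ^ γ` the leading term of the Cantor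
normal form, then `ℓ ^ ξ = ℓ ^ ξ' ∘ ℓ ^ (ω ^ γ)`. The theorems `isHyperlogFamily_hyperlog` and
`le_hyperlog` below show that this is the family of initial functions with `ℓ ^ 1 = ℓ` and
`ℓ ^ (α + β) = ℓ ^ β ∘ ℓ ^ α` in which each `ℓ ^ ξ` is pointwise maximal, given the
functions `ℓ ^ η` with `η < ξ`. -/
def hyperlog (ξ : Ordinal.{u}) : Ordinal.{u} → Ordinal.{u} :=
  if _h : ξ = 0 then id
  else hyperlog (ξ - ω ^ log ω ξ) ∘ hyperlogPow (log ω ξ)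
termination_by ξ
decreasing_by exact sub_omega0_opow_log_lt _h

/-! ### Icard topologies and reductive maps -/

/-- The Icard topology `I_lam` on the ordinal `Θ`, seen as the set of ordinals below `Θ`. For
`lam = 0` it is the topology of all downward closed sets; for `lam > 0` it is generated by the sets
`{ϑ | α < ℓ ^ ξ ϑ ≤ β}` and `{ϑ | ℓ ^ ξ ϑ ≤ β}` with `ξ < lam`. -/
abbrev icard (Θ lam : Ordinal.{u}) : TopologicalSpace (Set.Iio Θ) :=
  if lam = 0 then Topology.lowerSet (Set.Iio Θ)
  else TopologicalSpace.generateFrom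
    ({s | ∃ ξ < lam, ∃ β ≤ Θ, s = {ϑ | hyperlog ξ ϑ.1 ≤ β}} ∪
     {s | ∃ ξ < lam, ∃ β ≤ Θ, ∃ α < β, s = {ϑ | α < hyperlog ξ ϑ.1 ∧ hyperlog ξ ϑ.1 ≤ β}})

/-- A `d`-map: a continuous and open map all of whose fibres are discrete subspaces. -/
structure IsDMap {X Y : Type*} [TopologicalSpace X] [TopologicalSpace Y] (f : X → Y) :
    Prop where
  continuous : Continuous f
  isOpenMap : IsOpenMap f
  discrete : ∀ y, DiscreteTopology (f ⁻¹' {y})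

/-- `f` is locally `g`-determined: every point has a neighbourhood on which the value of `g`
determines that of `f`. -/
def LocallyDetermined {X Y Z : Type*} [TopologicalSpace X] (f : X → Y) (g : X → Z) : Prop :=
  ∀ x, ∃ U ∈ nhds x, ∀ y ∈ U, ∀ z ∈ U, g y = g z → f y = f z

/-- `f : Θ_{1 + Λ} → Ξ_1` is `Λ`-reductive: it is a `d`-map and, for every `lam < 1 + Λ`, it is
locally `ℓ ^ lam`-determined with respect to `I_lam`. -/
structure IsReductive {Θ Ξ : Ordinal.{u}} (Λ : Ordinal.{u}) (f : Set.Iio Θ → Set.Iio Ξ) :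
    Prop where
  isDMap : @IsDMap _ _ (icard Θ (1 + Λ)) (icard Ξ 1) f
  locallyDetermined : ∀ lam < 1 + Λ,
    @LocallyDetermined _ _ _ (icard Θ lam) f (fun ϑ => hyperlog lam ϑ.1)

/-! ### The hyperexponentials and hyperlogarithms are the intended ones -/

/-- A family of normal functions with `g ^ 1 = e` and `g ^ (α + β) = g ^ α ∘ g ^ β`. -/
structure IsHyperexpFamily (g : Ordinal.{u} → Ordinal.{u} → Ordinal.{u}) : Prop where
  normal : ∀ ζ, Order.IsNormal (g ζ)
  one : g 1 = expOne
  add : ∀ α β, g (α + β) = g α ∘ g β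

/-- A function is initial if it maps initial segments to initial segments. -/
def IsInitialFun (f : Ordinal.{u} → Ordinal.{u}) : Prop :=
  ∀ s : Set Ordinal.{u}, IsLowerSet s → IsLowerSet (f '' s)

/-- A family of initial functions with `g ^ 1 = ℓ` and `g ^ (α + β) = g ^ β ∘ g ^ α`. -/
structure IsHyperlogFamily (g : Ordinal.{u} → Ordinal.{u} → Ordinal.{u}) : Prop where
  initial : ∀ ζ, IsInitialFun (g ζ)
  one : g 1 = logOne
  add : ∀ α β, g (α + β) = g β ∘ g α

theorem isNormal_expOne : Order.IsNormal expOne.{u} := by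
  have h1 : ∀ ξ : Ordinal.{u}, 1 + expOne ξ = ω ^ ξ := fun ξ =>
    Ordinal.add_sub_cancel_of_le (Order.one_le_iff_pos.2 (opow_pos _ omega0_pos))
  have hw := isNormal_opow (one_lt_omega0.{u})
  refine Order.IsNormal.of_succ_lt (fun a => ?_) (fun {a} ha => ?_)
  · have : 1 + expOne a < 1 + expOne (Order.succ a) := by
      rw [h1, h1]; exact hw.strictMono (Order.lt_succ a)
    exact lt_of_add_lt_add_left this
  · refine ⟨?_, ?_⟩
    · rintro _ ⟨b, hb, rfl⟩
      have : 1 + expOne b ≤ 1 + expOne a := by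
        rw [h1, h1]; exact hw.strictMono.monotone (le_of_lt hb)
      exact le_of_add_le_add_left this
    · intro c hc
      have h2 : ω ^ a ≤ 1 + c := by
        refine (hw.le_iff_forall_le ha).2 fun b hb => ?_
        rw [← h1]
        gcongr
        exact hc ⟨b, hb, rfl⟩
      rw [← h1] at h2
      exact le_of_add_le_add_left h2

theorem hyperexp_zero : hyperexp.{u} 0 = id := by rw [hyperexp, dif_pos rfl]

theorem hyperexp_of_ne_zero {ζ : Ordinal.{u}} (h : ζ ≠ 0) :
    hyperexp ζ = veblenWith expOne (log ω ζ) ∘ hyperexp (ζ - ω ^ log ω ζ) := by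
  rw [hyperexp, dif_neg h]

theorem hyperlog_zero : hyperlog.{u} 0 = id := by rw [hyperlog, dif_pos rfl]

theorem hyperlog_of_ne_zero {ξ : Ordinal.{u}} (h : ξ ≠ 0) :
    hyperlog ξ = hyperlog (ξ - ω ^ log ω ξ) ∘ hyperlogPow (log ω ξ) := by
  rw [hyperlog, dif_neg h]

theorem log_opow_add {γ ζ : Ordinal.{u}} (h : log ω ζ ≤ γ) : log ω (ω ^ γ + ζ) = γ := by
  have hz : ζ < ω ^ Order.succ γ :=
    lt_opow_of_log_lt one_lt_omega0 (Order.lt_succ_of_le h)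
  have hpos : ω ^ γ + ζ ≠ 0 := by
    have := opow_pos γ omega0_pos
    exact (lt_of_lt_of_le this le_self_add).ne'
  apply le_antisymm
  · rw [← Order.lt_succ_iff, ← lt_opow_iff_log_lt one_lt_omega0 hpos]
    exact isPrincipal_add_omega0_opow _
      ((opow_lt_opow_iff_right one_lt_omega0).2 (Order.lt_succ γ)) hz
  · exact le_log_of_opow_le one_lt_omega0 le_self_add

theorem opow_add_eq_self {γ ζ : Ordinal.{u}} (hz : ζ ≠ 0) (h : γ < log ω ζ) :
    ω ^ γ + ζ = ζ :=
  add_of_omega0_opow_le ((opow_lt_opow_iff_right one_lt_omega0).2 h) (opow_log_le_self _ hz)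

theorem opow_log_add_sub {ζ : Ordinal.{u}} (hz : ζ ≠ 0) :
    ω ^ log ω ζ + (ζ - ω ^ log ω ζ) = ζ :=
  Ordinal.add_sub_cancel_of_le (opow_log_le_self _ hz)

theorem opow_add_ne_zero (γ ζ : Ordinal.{u}) : ω ^ γ + ζ ≠ 0 :=
  (lt_of_lt_of_le (opow_pos γ omega0_pos) le_self_add).ne'

theorem hyperexp_opow_add (γ ζ : Ordinal.{u}) :
    hyperexp (ω ^ γ + ζ) = veblenWith expOne γ ∘ hyperexp ζ := by
  by_cases h : log ω ζ ≤ γ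
  · rw [hyperexp_of_ne_zero (opow_add_ne_zero γ ζ), log_opow_add h, Ordinal.add_sub_cancel]
  · have hz : ζ ≠ 0 := by rintro rfl; simp at h
    rw [opow_add_eq_self hz (not_le.1 h), hyperexp_of_ne_zero hz]
    funext x
    simp only [Function.comp]
    rw [veblenWith_veblenWith_of_lt isNormal_expOne (not_le.1 h)]

theorem hyperexp_add (α β : Ordinal.{u}) : hyperexp (α + β) = hyperexp α ∘ hyperexp β := by
  induction α using WellFoundedLT.induction with
  | _ α ih =>
    by_cases h : α = 0
    · subst h; rw [zero_add, hyperexp_zero]; rfl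
    · have h1 := ih _ (sub_omega0_opow_log_lt h)
      rw [hyperexp_of_ne_zero h, Function.comp_assoc, ← h1, ← hyperexp_opow_add, ← add_assoc,
        opow_log_add_sub h]

theorem isNormal_hyperexp (ζ : Ordinal.{u}) : Order.IsNormal (hyperexp ζ) := by
  induction ζ using WellFoundedLT.induction with
  | _ ζ ih =>
    by_cases h : ζ = 0
    · subst h; rw [hyperexp_zero]; exact Order.IsNormal.id
    · rw [hyperexp_of_ne_zero h]
      exact (isNormal_veblenWith isNormal_expOne _).comp (ih _ (sub_omega0_opow_log_lt h))

theorem isHyperexpFamily_hyperexp : IsHyperexpFamily hyperexp.{u} where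
  normal := isNormal_hyperexp
  one := by
    have := hyperexp_opow_add 0 (0 : Ordinal.{u})
    rw [opow_zero, add_zero, veblenWith_zero, hyperexp_zero] at this
    exact this
  add := hyperexp_add

theorem IsHyperexpFamily.zero {g : Ordinal.{u} → Ordinal.{u} → Ordinal.{u}}
    (hg : IsHyperexpFamily g) : g 0 = id := by
  funext x
  have h := congrFun (hg.add 0 0) x
  rw [add_zero] at h
  exact ((hg.normal 0).strictMono.injective h).symm

/-- The hyperexponentials are the pointwise least family. -/
theorem hyperexp_le {g : Ordinal.{u} → Ordinal.{u} → Ordinal.{u}} (hg : IsHyperexpFamily g)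
    (ζ ξ : Ordinal.{u}) : hyperexp ζ ξ ≤ g ζ ξ := by
  have hN := isNormal_expOne.{u}
  have key : ∀ γ ξ : Ordinal.{u}, veblenWith expOne γ ξ ≤ g (ω ^ γ) ξ := by
    intro γ
    induction γ using WellFoundedLT.induction with
    | _ γ ih =>
      intro ξ
      by_cases h0 : γ = 0
      · subst h0; rw [opow_zero, hg.one, veblenWith_zero]
      · have hr : ∀ x, ∃ y, veblenWith expOne γ y = g (ω ^ γ) x := by
          intro x
          refine (mem_range_veblenWith hN h0).2 fun δ hδ => ?_
          apply le_antisymm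
          · refine (ih δ hδ _).trans ?_
            have := congrFun (hg.add (ω ^ δ) (ω ^ γ)) x
            rw [add_omega0_opow ((opow_lt_opow_iff_right one_lt_omega0).2 hδ)] at this
            exact this.ge
          · exact (isNormal_veblenWith hN δ).strictMono.le_apply
        choose η hη using hr
        have hmono : StrictMono η := by
          intro a b hab
          rw [← veblenWith_lt_veblenWith_iff_right hN (o := γ), hη, hη]
          exact (hg.normal _).strictMono hab
        rw [← hη]
        exact (isNormal_veblenWith hN γ).strictMono.monotone hmono.le_apply
  induction ζ using WellFoundedLT.induction generalizing ξ with
  | _ ζ ih =>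
    by_cases h : ζ = 0
    · subst h; rw [hyperexp_zero, hg.zero]
    · have h1 := ih _ (sub_omega0_opow_log_lt h) ξ
      have h2 := congrFun (hg.add (ω ^ log ω ζ) (ζ - ω ^ log ω ζ)) ξ
      rw [opow_log_add_sub h] at h2
      rw [hyperexp_of_ne_zero h, h2]
      exact ((isNormal_veblenWith hN _).strictMono.monotone h1).trans (key _ _)

theorem isInitialFun_of_forall {f : Ordinal.{u} → Ordinal.{u}}
    (hf : ∀ α, ∀ y < f α, ∃ x < α, f x = y) : IsInitialFun f := by
  rintro s hs _ y hy ⟨α, hα, rfl⟩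
  rcases hy.lt_or_eq with h | h
  · obtain ⟨x, hx, rfl⟩ := hf α y h
    exact ⟨x, hs hx.le hα, rfl⟩
  · exact ⟨α, hα, h.symm⟩

theorem IsInitialFun.exists_lt {f : Ordinal.{u} → Ordinal.{u}} (hf : IsInitialFun f)
    {α y : Ordinal.{u}} (hy : y < f α) : ∃ x < α, f x = y := by
  obtain ⟨x, hx, rfl⟩ := hf (Set.Iic α) (isLowerSet_Iic α) hy.le ⟨α, Set.mem_Iic.2 le_rfl, rfl⟩
  refine ⟨x, lt_of_le_of_ne hx ?_, rfl⟩
  rintro rfl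
  exact lt_irrefl _ hy

theorem IsInitialFun.le_self {f : Ordinal.{u} → Ordinal.{u}} (hf : IsInitialFun f)
    (α : Ordinal.{u}) : f α ≤ α := by
  induction α using WellFoundedLT.induction with
  | _ α ih =>
    by_contra h
    obtain ⟨x, hx, h1⟩ := hf.exists_lt (not_le.1 h)
    exact absurd (ih x hx) (not_le.2 (h1 ▸ hx))

theorem IsInitialFun.comp {f g : Ordinal.{u} → Ordinal.{u}} (hf : IsInitialFun f)
    (hg : IsInitialFun g) : IsInitialFun (f ∘ g) := fun s hs => by
  rw [Set.image_comp]; exact hf _ (hg _ hs)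

theorem eq_of_opow_eq_add_opow {y α β : Ordinal.{u}} (h : ω ^ y = α + ω ^ β) : β = y := by
  have hb : β ≤ y := (opow_le_opow_iff_right one_lt_omega0).1 (h ▸ le_add_self)
  refine hb.eq_of_not_lt fun hlt => ?_
  have ha : α < ω ^ y := by
    rw [h]; exact (lt_add_iff_pos_right _).2 (opow_pos _ omega0_pos)
  have := isPrincipal_add_omega0_opow y ha ((opow_lt_opow_iff_right one_lt_omega0).2 hlt)
  exact absurd this (by simp only [← h, lt_irrefl, not_false_eq_true])

theorem logOne_opow (y : Ordinal.{u}) : logOne (ω ^ y) = y := by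
  have : {β : Ordinal.{u} | ∃ α, ω ^ y = α + ω ^ β} = {y} := by
    ext β
    constructor
    · rintro ⟨α, h⟩; exact eq_of_opow_eq_add_opow h
    · rintro rfl; exact ⟨0, (zero_add _).symm⟩
  rw [logOne, this, csInf_singleton]

theorem isInitialFun_logOne : IsInitialFun logOne.{u} := by
  refine isInitialFun_of_forall fun α y hy => ⟨ω ^ y, ?_, logOne_opow y⟩
  have hne : {β : Ordinal.{u} | ∃ a, α = a + ω ^ β}.Nonempty := by
    rw [Set.nonempty_iff_ne_empty]
    intro h
    have h0 : logOne α = 0 := (congrArg sInf h).trans Ordinal.sInf_empty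
    rw [h0] at hy
    exact not_lt_zero hy
  obtain ⟨a, ha⟩ : ∃ a, α = a + ω ^ logOne α := csInf_mem hne
  calc ω ^ y < ω ^ logOne α := (opow_lt_opow_iff_right one_lt_omega0).2 hy
    _ ≤ a + ω ^ logOne α := le_add_self
    _ = α := ha.symm

theorem isInitialFun_hyperlogStep (γ : Ordinal.{u}) (L : Set.Iio γ → Ordinal.{u} → Ordinal.{u}) :
    IsInitialFun (hyperlogStep γ L) := by
  refine isInitialFun_of_forall fun α => ?_
  induction α using WellFoundedLT.induction with
  | _ α ih =>
    intro y hy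
    rw [hyperlogStep] at hy
    split_ifs at hy with h
    · obtain ⟨x, hx, hxy⟩ := ih _ h y hy
      exact ⟨x, hx.trans h, hxy⟩
    · rw [Ordinal.lt_iSup_iff] at hy
      obtain ⟨⟨ζ, hζ⟩, hy⟩ := hy
      rcases (Order.lt_succ_iff.1 hy).lt_or_eq with h1 | h1
      · obtain ⟨x, hx, hxy⟩ := ih ζ hζ y h1
        exact ⟨x, hx.trans hζ, hxy⟩
      · exact ⟨ζ, hζ, h1.symm⟩

theorem hyperlogPow_zero : hyperlogPow.{u} 0 = logOne := by rw [hyperlogPow, if_pos rfl]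

theorem hyperlogPow_of_ne_zero {γ : Ordinal.{u}} (h : γ ≠ 0) :
    hyperlogPow γ = hyperlogStep γ fun δ => hyperlogPow δ.1 := by
  rw [hyperlogPow, if_neg h]

theorem isInitialFun_hyperlogPow (γ : Ordinal.{u}) : IsInitialFun (hyperlogPow γ) := by
  by_cases h : γ = 0
  · subst h; rw [hyperlogPow_zero]; exact isInitialFun_logOne
  · rw [hyperlogPow_of_ne_zero h]; exact isInitialFun_hyperlogStep _ _

/-- The case distinction in the definition of `ℓ ^ (ω ^ γ)`. -/
theorem hyperlogPow_cases {γ : Ordinal.{u}} (h : γ ≠ 0) (α : Ordinal.{u}) :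
    (∃ δ < γ, (∀ δ' < γ, hyperlogPow δ α ≤ hyperlogPow δ' α) ∧ hyperlogPow δ α < α ∧
      hyperlogPow γ α = hyperlogPow γ (hyperlogPow δ α)) ∨
    ((∀ δ < γ, hyperlogPow δ α = α) ∧
      hyperlogPow γ α = ⨆ ζ : Set.Iio α, Order.succ (hyperlogPow γ ζ.1)) := by
  have hne : (Set.range fun δ : Set.Iio γ => hyperlogPow δ.1 α).Nonempty :=
    ⟨_, ⟨0, pos_iff_ne_zero.2 h⟩, rfl⟩
  by_cases hm : sInf (Set.range fun δ : Set.Iio γ => hyperlogPow δ.1 α) < α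
  · left
    obtain ⟨⟨δ, hδ⟩, hδm⟩ := csInf_mem hne
    simp only at hδm
    refine ⟨δ, hδ, fun δ' hδ' => ?_, hδm ▸ hm, ?_⟩
    · rw [hδm]; exact csInf_le' ⟨⟨δ', hδ'⟩, rfl⟩
    · rw [hδm, hyperlogPow_of_ne_zero h, hyperlogStep, dif_pos hm]
  · right
    refine ⟨fun δ hδ => le_antisymm ((isInitialFun_hyperlogPow δ).le_self α) ?_, ?_⟩
    · exact (not_lt.1 hm).trans (csInf_le' ⟨⟨δ, hδ⟩, rfl⟩)
    · rw [hyperlogPow_of_ne_zero h, hyperlogStep, dif_neg hm]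

theorem hyperlogPow_hyperlogPow {δ γ : Ordinal.{u}} (h : δ < γ) (α : Ordinal.{u}) :
    hyperlogPow γ (hyperlogPow δ α) = hyperlogPow γ α := by
  induction γ using WellFoundedLT.induction generalizing δ α with
  | _ γ ihγ =>
    induction α using WellFoundedLT.induction generalizing δ with
    | _ α ihα =>
      have h0 : γ ≠ 0 := (pos_of_gt h).ne'
      rcases hyperlogPow_cases h0 α with ⟨ε, hε, hmin, hlt, heq⟩ | ⟨hfix, -⟩
      · rw [heq]
        rcases lt_trichotomy δ ε with hd | rfl | hd
        · by_cases hα : hyperlogPow δ α = α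
          · rw [hα, heq]
          · have hδα := lt_of_le_of_ne ((isInitialFun_hyperlogPow δ).le_self α) hα
            rw [← ihα _ hδα hε, ihγ ε hε hd]
        · rfl
        · have h1 : hyperlogPow δ α = hyperlogPow ε α := by
            apply le_antisymm _ (hmin δ h)
            rw [← ihγ δ h hd]
            exact (isInitialFun_hyperlogPow δ).le_self _
          rw [h1]
      · rw [hfix δ h]

theorem hyperlog_opow_add (γ ξ : Ordinal.{u}) :
    hyperlog (ω ^ γ + ξ) = hyperlog ξ ∘ hyperlogPow γ := by
  by_cases h : log ω ξ ≤ γ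
  · rw [hyperlog_of_ne_zero (opow_add_ne_zero γ ξ), log_opow_add h, Ordinal.add_sub_cancel]
  · have hz : ξ ≠ 0 := by rintro rfl; simp at h
    rw [opow_add_eq_self hz (not_le.1 h), hyperlog_of_ne_zero hz]
    funext x
    simp only [Function.comp]
    rw [hyperlogPow_hyperlogPow (not_le.1 h)]

theorem hyperlog_opow (γ : Ordinal.{u}) : hyperlog (ω ^ γ) = hyperlogPow γ := by
  have := hyperlog_opow_add γ 0
  rwa [add_zero, hyperlog_zero] at this

theorem hyperlog_add (α β : Ordinal.{u}) : hyperlog (α + β) = hyperlog β ∘ hyperlog α := by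
  induction α using WellFoundedLT.induction with
  | _ α ih =>
    by_cases h : α = 0
    · subst h; rw [zero_add, hyperlog_zero]; rfl
    · have h1 := ih _ (sub_omega0_opow_log_lt h)
      rw [hyperlog_of_ne_zero h, ← Function.comp_assoc, ← h1, ← hyperlog_opow_add, ← add_assoc,
        opow_log_add_sub h]

theorem isInitialFun_hyperlog (ξ : Ordinal.{u}) : IsInitialFun (hyperlog ξ) := by
  induction ξ using WellFoundedLT.induction with
  | _ ξ ih =>
    by_cases h : ξ = 0
    · subst h; rw [hyperlog_zero]; intro s hs; rwa [Set.image_id]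
    · rw [hyperlog_of_ne_zero h]
      exact (ih _ (sub_omega0_opow_log_lt h)).comp (isInitialFun_hyperlogPow _)

theorem isHyperlogFamily_hyperlog : IsHyperlogFamily hyperlog.{u} where
  initial := isInitialFun_hyperlog
  one := by
    have := hyperlog_opow (0 : Ordinal.{u})
    rwa [opow_zero, hyperlogPow_zero] at this
  add := hyperlog_add

/-- Each `ℓ ^ ξ` is pointwise maximal, given the functions `ℓ ^ η` with `η < ξ`. -/
theorem le_hyperlog {g : Ordinal.{u} → Ordinal.{u} → Ordinal.{u}} (hg : IsHyperlogFamily g)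
    {ξ : Ordinal.{u}} (h : ∀ η < ξ, g η = hyperlog η) (α : Ordinal.{u}) :
    g ξ α ≤ hyperlog ξ α := by
  by_cases h0 : ξ = 0
  · subst h0; rw [hyperlog_zero]; exact (hg.initial 0).le_self α
  have hdec := opow_log_add_sub h0
  set γ := log ω ξ
  by_cases hr : ξ - ω ^ γ = 0
  · rw [hr, add_zero] at hdec
    rw [← hdec]
    by_cases hγ : γ = 0
    · rw [hγ, opow_zero, hg.one, isHyperlogFamily_hyperlog.one]
    rw [hyperlog_opow]
    induction α using WellFoundedLT.induction with
    | _ α ih =>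
      rcases hyperlogPow_cases hγ α with ⟨δ, hδ, -, hlt, heq⟩ | ⟨-, heq⟩
      · have hlt' : ω ^ δ < ω ^ γ := (opow_lt_opow_iff_right one_lt_omega0).2 hδ
        have h1 := congrFun (hg.add (ω ^ δ) (ω ^ γ)) α
        rw [add_omega0_opow hlt', Function.comp, h (ω ^ δ) (hlt'.trans_eq hdec), hyperlog_opow] at h1
        rw [h1, heq]
        exact ih _ hlt
      · by_contra hcon
        obtain ⟨ζ, hζ, h1⟩ := (hg.initial _).exists_lt (not_le.1 hcon)
        have h2 : Order.succ (hyperlogPow γ ζ) ≤ hyperlogPow γ α := by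
          rw [heq]
          exact Ordinal.le_iSup (fun ζ : Set.Iio α => Order.succ (hyperlogPow γ ζ.1)) ⟨ζ, hζ⟩
        rw [← h1] at h2
        exact absurd (ih ζ hζ) (not_le.2 (Order.succ_le_iff.1 h2))
  · have h1 : ω ^ γ < ξ := by
      conv_rhs => rw [← hdec]
      exact (lt_add_iff_pos_right _).2 (pos_iff_ne_zero.2 hr)
    have h2 : ξ - ω ^ γ < ξ := sub_omega0_opow_log_lt h0
    rw [← hdec, hg.add, hyperlog_add, h _ h1, h _ h2]

/-- `I_1` is the interval topology. -/
theorem icard_one (Θ : Ordinal.{u}) :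
    icard Θ 1 = (instTopologicalSpaceSubtype : TopologicalSpace (Set.Iio Θ)) := by
  rw [icard, if_neg one_ne_zero]
  apply le_antisymm
  · rw [OrderTopology.topology_eq_generate_intervals (α := Set.Iio Θ)]
    refine le_generateFrom ?_
    rintro _ ⟨a, rfl | rfl⟩
    · refine TopologicalSpace.isOpen_generateFrom_of_mem (Or.inr
        ⟨0, one_pos, Θ, le_rfl, a.1, a.2, ?_⟩)
      ext x
      rw [hyperlog_zero]
      exact ⟨fun h => ⟨h, x.2.le⟩, fun h => h.1⟩
    · have : Set.Iio a = ⋃ b : Set.Iio a, {x : Set.Iio Θ | hyperlog 0 x.1 ≤ b.1.1} := by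
        ext x
        rw [hyperlog_zero, Set.mem_iUnion]
        exact ⟨fun h => ⟨⟨x, h⟩, le_refl x.1⟩, fun ⟨b, hb⟩ => lt_of_le_of_lt (b := b.1) hb b.2⟩
      rw [this]
      refine @isOpen_iUnion _ _ (TopologicalSpace.generateFrom _) _ fun b => ?_
      exact TopologicalSpace.isOpen_generateFrom_of_mem (Or.inl
        ⟨0, one_pos, b.1.1, (b.1.2 : b.1.1 < Θ).le, rfl⟩)
  · have h1 : ∀ β : Ordinal.{u}, IsOpen {x : Set.Iio Θ | x.1 ≤ β} := fun β => by
      have : {x : Set.Iio Θ | x.1 ≤ β} = Subtype.val ⁻¹' Set.Iio (Order.succ β) := by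
        ext x; exact (Order.lt_succ_iff (a := x.1) (b := β)).symm
      rw [this]
      exact isOpen_Iio.preimage continuous_subtype_val
    refine le_generateFrom ?_
    rintro _ (⟨ξ, hξ, β, -, rfl⟩ | ⟨ξ, hξ, β, -, α, -, rfl⟩)
    · rw [Order.lt_one_iff.1 hξ, hyperlog_zero]
      exact h1 β
    · rw [Order.lt_one_iff.1 hξ, hyperlog_zero]
      exact (isOpen_Ioi.preimage continuous_subtype_val).inter (h1 β)

end Reductive

end

noncomputable section

namespace Reductive

open Filter Topology

/-! The problem is moved to the class of all ordinals by the filters `icardNhds μ x`. In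
`IsReduction`, the equality `map f (icardNhds μ x) = 𝓝 (f x)` is continuity (`≤`) and openness (`≥`)
at `x`, and `eventually_eq` is discreteness of fibres.

For `ν ≠ 0` the hyperlogarithm `ℓ ^ μ` is itself a `d`-map from `I_(μ + ν)` to `I_ν`
(`map_hyperlog_icardNhds`, `eventually_eq_of_hyperlog_eq`), so a reduction for `ν` composed with `ℓ
^ μ` is one for `μ + ν` (`IsReduction.comp_hyperlog`). Writing `1 + Λ = α + ω ^ γ` leaves only `ν =
ω ^ γ`; for `γ = 0` the identity works.

For `γ > 0` the proof is by induction on `Θ`, with `Θ = 0` trivial. By countability there are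
sequences `σ n` cofinal in `ν` and `θ n` cofinal in `Θ`. For `x < e ^ ν Θ` the decreasing values `ℓ
^ (σ n) x` stabilise at a value of `e ^ ν` below `e ^ ν Θ`, so some `ℓ ^ (σ n) x` is at most `e ^ ν
(θ n)` (`exists_enters`). At the first such `n` the reduction for `θ n` is applied to `ℓ ^ (σ n) x`,
and the result is placed in the `n`-th block of `e Θ = ∑ (e (θ n) + 1)`; the top point goes to `e Θ`
(`isReduction_glue`). Since `σ n + ν = ν`, each piece is again a `d`-map for `I_ν`. Determination by
`ℓ ^ lam` survives because only finitely many stages have `σ n < lam`, while the later ones see `x`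
only through `ℓ ^ lam x`. -/

/-! ### Last Cantor exponents and the functions `e` and `ℓ` -/

theorem exists_eq_add_opow {ξ : Ordinal.{u}} (h : ξ ≠ 0) : ∃ α β : Ordinal.{u}, ξ = α + ω ^ β := by
  induction ξ using WellFoundedLT.induction with
  | _ ξ ih =>
    have hdec := opow_log_add_sub h
    by_cases hr : ξ - ω ^ log ω ξ = 0
    · rw [hr, add_zero] at hdec
      exact ⟨0, log ω ξ, by rw [zero_add, hdec]⟩
    · obtain ⟨α, β, hαβ⟩ := ih _ (sub_omega0_opow_log_lt h) hr
      exact ⟨ω ^ log ω ξ + α, β, by rw [add_assoc, ← hαβ, hdec]⟩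

theorem add_opow_inj {α α' β β' : Ordinal.{u}} (h : α + ω ^ β = α' + ω ^ β') : β = β' := by
  wlog hle : α ≤ α' generalizing α α' β β'
  · exact (this h.symm (le_of_not_ge hle)).symm
  rw [← Ordinal.add_sub_cancel_of_le hle, add_assoc] at h
  exact (eq_of_opow_eq_add_opow (add_left_cancel h)).symm

theorem logOne_add_opow (α β : Ordinal.{u}) : logOne (α + ω ^ β) = β := by
  have : {b : Ordinal.{u} | ∃ a, α + ω ^ β = a + ω ^ b} = {β} := by
    ext b
    constructor
    · rintro ⟨a, h⟩; exact (add_opow_inj h).symm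
    · rintro rfl; exact ⟨α, rfl⟩
  rw [logOne, this, csInf_singleton]

theorem logOne_zero : logOne (0 : Ordinal.{u}) = 0 :=
  nonpos_iff_eq_zero.1 (isInitialFun_logOne.le_self 0)

theorem exists_eq_add_opow_logOne {ξ : Ordinal.{u}} (h : ξ ≠ 0) :
    ∃ α : Ordinal.{u}, ξ = α + ω ^ logOne ξ := by
  obtain ⟨α, β, rfl⟩ := exists_eq_add_opow h
  exact ⟨α, by rw [logOne_add_opow]⟩

theorem expOne_zero : expOne (0 : Ordinal.{u}) = 0 := by simp [expOne]

theorem expOne_of_ne_zero {ξ : Ordinal.{u}} (h : ξ ≠ 0) : expOne ξ = ω ^ ξ := by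
  have h1 : 1 + ω ^ ξ = ω ^ ξ :=
    one_add_of_omega0_le (left_le_opow _ (pos_iff_ne_zero.2 h))
  rw [expOne]
  conv_lhs => rw [← h1]
  exact Ordinal.add_sub_cancel _ _

theorem expOne_le_opow (ξ : Ordinal.{u}) : expOne ξ ≤ ω ^ ξ := Ordinal.sub_le_self _ _

theorem opow_le_expOne_add_one (ξ : Ordinal.{u}) : ω ^ ξ ≤ expOne ξ + 1 := by
  rcases eq_or_ne ξ 0 with rfl | h
  · simp [expOne_zero]
  · rw [expOne_of_ne_zero h]; exact le_self_add

theorem logOne_expOne (ξ : Ordinal.{u}) : logOne (expOne ξ) = ξ := by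
  rcases eq_or_ne ξ 0 with rfl | h
  · rw [expOne_zero, logOne_zero]
  · rw [expOne_of_ne_zero h, logOne_opow]

theorem expOne_logOne_le (z : Ordinal.{u}) : expOne (logOne z) ≤ z := by
  rcases eq_or_ne z 0 with rfl | h
  · rw [logOne_zero, expOne_zero]
  · obtain ⟨α, hα⟩ := exists_eq_add_opow_logOne h
    refine (expOne_le_opow _).trans ?_
    conv_rhs => rw [hα]
    exact le_add_self

/-! ### Hyperlogarithms as left inverses of hyperexponentials -/

theorem hyperexp_opow (γ : Ordinal.{u}) : hyperexp (ω ^ γ) = veblenWith expOne γ := by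
  have := hyperexp_opow_add γ 0
  rwa [add_zero, hyperexp_zero] at this

/-- The principle by which properties of `e ^ μ` and `ℓ ^ μ` are reduced to `μ = ω ^ γ`. -/
theorem hyper_induction {P : Ordinal.{u} → Prop} (zero : P 0) (add : ∀ α β, P α → P β → P (α + β))
    (opow : ∀ γ : Ordinal.{u}, (∀ μ < ω ^ γ, P μ) → P (ω ^ γ)) (μ : Ordinal.{u}) : P μ := by
  induction μ using WellFoundedLT.induction with
  | _ μ ih =>
    rcases eq_or_ne μ 0 with rfl | h
    · exact zero
    · have hdec := opow_log_add_sub h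
      rcases (opow_log_le_self ω h).lt_or_eq with hlt | heq
      · rw [← hdec]
        exact add _ _ (ih _ hlt) (ih _ (sub_omega0_opow_log_lt h))
      · rw [← heq] at ih ⊢
        exact opow _ ih

theorem hyperlog_opow_of_fixed {γ x : Ordinal.{u}} (hγ : γ ≠ 0)
    (hx : ∀ δ < γ, hyperlogPow δ x = x) :
    hyperlog (ω ^ γ) x = ⨆ ζ : Set.Iio x, Order.succ (hyperlog (ω ^ γ) ζ.1) := by
  rw [hyperlog_opow]
  rcases hyperlogPow_cases hγ x with ⟨δ, hδ, -, hlt, -⟩ | ⟨-, h⟩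
  · exact absurd (hx δ hδ) hlt.ne
  · exact h

/-- The Veblen function at `γ` enumerates the common fixed points of the earlier ones; these are
inflationary, so `≤` already means fixed. -/
theorem mem_range_hyperexp_of_fixed {γ z : Ordinal.{u}} (hγ : γ ≠ 0)
    (hz : ∀ δ < γ, hyperexp (ω ^ δ) z ≤ z) : ∃ η, hyperexp (ω ^ γ) η = z := by
  rw [hyperexp_opow]
  refine (mem_range_veblenWith isNormal_expOne hγ).2 fun δ hδ => ?_
  have := hz δ hδ
  rw [hyperexp_opow] at this
  exact this.antisymm (isNormal_veblenWith isNormal_expOne δ).strictMono.le_apply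

/-- Both claims pass to sums. At `ω ^ γ` with `γ > 0`, a point moved by some `ℓ ^ (ω ^ δ)` reduces
to a smaller one. A point fixed by all of them is, by the inequality for `ω ^ δ`, of the form `e ^
(ω ^ γ) η`, and the supremum clause bounds its logarithm by `η`. Conversely `e ^ (ω ^ γ) ξ` is
fixed, and the supremum clause there exceeds every `ξ' < ξ`. -/
theorem hyperexp_hyperlog_le_and_hyperlog_hyperexp (μ : Ordinal.{u}) :
    (∀ z, hyperexp μ (hyperlog μ z) ≤ z) ∧ ∀ ξ, hyperlog μ (hyperexp μ ξ) = ξ := by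
  induction μ using hyper_induction with
  | zero => simp [hyperexp_zero, hyperlog_zero]
  | add α β hα hβ =>
    refine ⟨fun z => ?_, fun ξ => ?_⟩
    · rw [hyperexp_add, hyperlog_add]
      exact ((isNormal_hyperexp α).strictMono.monotone (hβ.1 _)).trans (hα.1 z)
    · rw [hyperexp_add, hyperlog_add]
      simp only [Function.comp, hα.2, hβ.2]
  | opow γ ih =>
    rcases eq_or_ne γ 0 with rfl | hγ
    · rw [opow_zero, isHyperexpFamily_hyperexp.one, isHyperlogFamily_hyperlog.one]
      exact ⟨expOne_logOne_le, logOne_expOne⟩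
    have hlt : ∀ δ < γ, ω ^ δ < ω ^ γ := fun δ hδ => (opow_lt_opow_iff_right one_lt_omega0).2 hδ
    have hmono := (isNormal_hyperexp (ω ^ γ)).strictMono
    have h1 : ∀ z, hyperexp (ω ^ γ) (hyperlog (ω ^ γ) z) ≤ z := by
      intro z
      induction z using WellFoundedLT.induction with
      | _ z ihz =>
        by_cases hz : ∀ δ < γ, hyperlogPow δ z = z
        · obtain ⟨η, hη⟩ := mem_range_hyperexp_of_fixed hγ (z := z) fun δ hδ => by
            have := (ih _ (hlt δ hδ)).1 z
            rwa [hyperlog_opow, hz δ hδ] at this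
          conv_rhs => rw [← hη]
          refine hmono.monotone ?_
          rw [hyperlog_opow_of_fixed hγ hz]
          refine Ordinal.iSup_le fun ζ => Order.succ_le_of_lt ?_
          rw [← hmono.lt_iff_lt, hη]
          exact (ihz ζ.1 ζ.2).trans_lt ζ.2
        · push Not at hz
          obtain ⟨δ, hδ, hne⟩ := hz
          have hlt' := lt_of_le_of_ne ((isInitialFun_hyperlogPow δ).le_self z) hne
          have := ihz _ hlt'
          rw [hyperlog_opow, hyperlogPow_hyperlogPow hδ, ← hyperlog_opow] at this
          exact this.trans hlt'.le
    refine ⟨h1, fun ξ => ?_⟩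
    induction ξ using WellFoundedLT.induction with
    | _ ξ ihξ =>
      refine le_antisymm (hmono.le_iff_le.1 (h1 _)) (le_of_forall_lt fun ξ' hξ' => ?_)
      rw [hyperlog_opow_of_fixed hγ (x := hyperexp (ω ^ γ) ξ)]
      · rw [Ordinal.lt_iSup_iff]
        exact ⟨⟨hyperexp (ω ^ γ) ξ', hmono hξ'⟩, by rw [ihξ ξ' hξ']; exact Order.lt_succ _⟩
      · intro δ hδ
        have h2 := (ih _ (hlt δ hδ)).2 (hyperexp (ω ^ γ) ξ)
        have h3 := congrFun (hyperexp_add (ω ^ δ) (ω ^ γ)) ξ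
        rw [add_omega0_opow (hlt δ hδ), Function.comp] at h3
        rwa [← h3, hyperlog_opow] at h2

theorem hyperexp_hyperlog_le (μ z : Ordinal.{u}) : hyperexp μ (hyperlog μ z) ≤ z :=
  (hyperexp_hyperlog_le_and_hyperlog_hyperexp μ).1 z

theorem hyperlog_hyperexp (μ ξ : Ordinal.{u}) : hyperlog μ (hyperexp μ ξ) = ξ :=
  (hyperexp_hyperlog_le_and_hyperlog_hyperexp μ).2 ξ

theorem hyperlog_le_of_le_hyperexp {μ z ξ : Ordinal.{u}} (h : z ≤ hyperexp μ ξ) :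
    hyperlog μ z ≤ ξ :=
  (isNormal_hyperexp μ).strictMono.le_iff_le.1 ((hyperexp_hyperlog_le μ z).trans h)

theorem hyperlog_le_self (μ z : Ordinal.{u}) : hyperlog μ z ≤ z :=
  (isInitialFun_hyperlog μ).le_self z

theorem hyperlog_hyperlog_add (α β z : Ordinal.{u}) :
    hyperlog β (hyperlog α z) = hyperlog (α + β) z := by rw [hyperlog_add]; rfl

theorem hyperlog_antitone (z : Ordinal.{u}) : Antitone fun μ => hyperlog μ z := by
  intro α β h
  simp only
  rw [← Ordinal.add_sub_cancel_of_le h, ← hyperlog_hyperlog_add]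
  exact hyperlog_le_self _ _

theorem hyperlog_congr {α β y z : Ordinal.{u}} (h : α ≤ β) (hyz : hyperlog α y = hyperlog α z) :
    hyperlog β y = hyperlog β z := by
  rw [← Ordinal.add_sub_cancel_of_le h, ← hyperlog_hyperlog_add, ← hyperlog_hyperlog_add, hyz]

theorem hyperlog_fixed {μ ν ξ : Ordinal.{u}} (h : μ + ν = ν) :
    hyperlog μ (hyperexp ν ξ) = hyperexp ν ξ := by
  conv_lhs => rw [← h, hyperexp_add]
  exact hyperlog_hyperexp _ _

/-! ### Neighbourhood filters of the Icard topologies -/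

/-- The filter of neighbourhoods of `x` in the topology on all ordinals induced by the functions
`ℓ ^ ξ` with `ξ < μ`. -/
def icardNhds (μ x : Ordinal.{u}) : Filter Ordinal.{u} :=
  ⨅ ξ : Set.Iio μ, comap (hyperlog ξ.1) (𝓝 (hyperlog ξ.1 x))

theorem icardNhds_zero (x : Ordinal.{u}) : icardNhds 0 x = ⊤ := by
  rw [icardNhds, iInf_eq_top]
  rintro ⟨ξ, hξ⟩
  exact absurd (show ξ < 0 from hξ) not_lt_zero

theorem icardNhds_anti {μ ν : Ordinal.{u}} (h : μ ≤ ν) (x : Ordinal.{u}) :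
    icardNhds ν x ≤ icardNhds μ x :=
  le_iInf fun ξ => iInf_le_of_le ⟨ξ.1, lt_of_lt_of_le (b := μ) ξ.2 h⟩ le_rfl

theorem tendsto_hyperlog_icardNhds {ξ μ : Ordinal.{u}} (h : ξ < μ) (x : Ordinal.{u}) :
    Tendsto (hyperlog ξ) (icardNhds μ x) (𝓝 (hyperlog ξ x)) :=
  tendsto_iff_comap.2 (iInf_le_of_le ⟨ξ, h⟩ le_rfl)

theorem pure_le_icardNhds (μ x : Ordinal.{u}) : pure x ≤ icardNhds μ x :=
  le_iInf fun ξ => by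
    rw [← tendsto_iff_comap, tendsto_pure_left]
    exact fun _ hs => mem_of_mem_nhds hs

theorem icardNhds_one (x : Ordinal.{u}) : icardNhds 1 x = 𝓝 x := by
  apply le_antisymm
  · have := tendsto_hyperlog_icardNhds (zero_lt_one (α := Ordinal.{u})) x
    rwa [hyperlog_zero] at this
  · refine le_iInf fun ξ => ?_
    rw [Order.lt_one_iff.1 (show ξ.1 < 1 from ξ.2), hyperlog_zero, comap_id]
    exact le_rfl

/-- The defining functions `ℓ ^ ξ` with `ξ ≥ α` factor through `ℓ ^ α`. -/
theorem icardNhds_add (α β x : Ordinal.{u}) :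
    icardNhds (α + β) x = icardNhds α x ⊓ comap (hyperlog α) (icardNhds β (hyperlog α x)) := by
  apply le_antisymm
  · refine le_inf (icardNhds_anti le_self_add x) ?_
    simp only [icardNhds, comap_iInf, comap_comap]
    refine le_iInf fun ξ => iInf_le_of_le ⟨α + ξ.1, add_lt_add_right (show ξ.1 < β from ξ.2) α⟩ ?_
    rw [hyperlog_add]
    exact le_rfl
  · refine le_iInf fun ξ => ?_
    rcases lt_or_ge ξ.1 α with h | h
    · exact inf_le_left.trans (iInf_le_of_le ⟨ξ.1, h⟩ le_rfl)
    · refine inf_le_right.trans ?_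
      have hξ : ξ.1 - α < β := by
        rw [Ordinal.sub_lt_of_le h]; exact ξ.2
      have := Filter.comap_mono (m := hyperlog α)
        (tendsto_iff_comap.1 (tendsto_hyperlog_icardNhds hξ (hyperlog α x)))
      refine this.trans ?_
      rw [comap_comap, ← hyperlog_add, hyperlog_hyperlog_add, Ordinal.add_sub_cancel_of_le h]

theorem Iic_mem_nhds_ordinal (x : Ordinal.{u}) : Set.Iic x ∈ 𝓝 x := by
  rw [← Order.Iio_succ]
  exact isOpen_Iio.mem_nhds (Order.lt_succ x)

theorem icardNhds_le_nhds {μ : Ordinal.{u}} (h : μ ≠ 0) (x : Ordinal.{u}) :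
    icardNhds μ x ≤ 𝓝 x := by
  rw [← icardNhds_one]
  exact icardNhds_anti (Order.one_le_iff_pos.2 (pos_iff_ne_zero.2 h)) x

theorem eventually_lt_hyperlog {ξ μ a x : Ordinal.{u}} (h : ξ < μ) (ha : a < hyperlog ξ x) :
    ∀ᶠ z in icardNhds μ x, a < hyperlog ξ z :=
  (tendsto_hyperlog_icardNhds h x).eventually (lt_mem_nhds ha)

theorem eventually_hyperlog_le {ξ μ x : Ordinal.{u}} (h : ξ < μ) :
    ∀ᶠ z in icardNhds μ x, hyperlog ξ z ≤ hyperlog ξ x :=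
  (tendsto_hyperlog_icardNhds h x).eventually (Iic_mem_nhds_ordinal _)

theorem mem_icardNhds_of_isSuccLimit {μ x : Ordinal.{u}} (h : Order.IsSuccLimit μ)
    {U : Set Ordinal.{u}} (hU : U ∈ icardNhds μ x) : ∃ ξ < μ, U ∈ icardNhds ξ x := by
  have hle : ⨅ ξ : Set.Iio μ, icardNhds ξ.1 x ≤ icardNhds μ x :=
    le_iInf fun ξ => iInf_le_of_le ⟨Order.succ ξ.1, h.succ_lt ξ.2⟩
      (tendsto_iff_comap.1 (tendsto_hyperlog_icardNhds (Order.lt_succ ξ.1) x))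
  have : Nonempty (Set.Iio μ) := ⟨⟨0, h.bot_lt⟩⟩
  have := hle hU
  rw [mem_iInf_of_directed] at this
  · obtain ⟨ξ, hξ⟩ := this
    exact ⟨ξ.1, ξ.2, hξ⟩
  · exact Antitone.directed_ge fun a b hab => icardNhds_anti hab x

/-! ### Hyperlogarithms are `d`-maps -/

/-- If `x = c + ω ^ β` and `y < β`, additive indecomposability of `ω ^ β` puts `max a c + ω ^ y`
strictly between `a` and `x` for every `a < x`. -/
theorem principal_Iic_logOne_le_map (x : Ordinal.{u}) :
    𝓟 (Set.Iic (logOne x)) ≤ map logOne (𝓝 x) := by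
  intro U hU
  rw [mem_principal]
  intro y hy
  rcases (show y ≤ logOne x from hy).eq_or_lt with rfl | hlt
  · exact mem_of_mem_nhds (x := x) (mem_map.1 hU)
  have hx : x ≠ 0 := by
    rintro rfl
    rw [logOne_zero] at hlt
    exact not_lt_zero hlt
  obtain ⟨c, hc⟩ := exists_eq_add_opow_logOne hx
  obtain ⟨a, hax, ha⟩ := exists_Ioc_subset_of_mem_nhds (mem_map.1 hU) ⟨0, pos_iff_ne_zero.2 hx⟩
  have hcm : c ≤ max a c := le_max_right _ _
  have hcx : c < x := by
    rw [hc]; exact (lt_add_iff_pos_right _).2 (opow_pos _ omega0_pos)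
  have hmx : max a c - c < ω ^ logOne x := by
    rw [Ordinal.sub_lt_of_le hcm, ← hc]; exact max_lt hax hcx
  have h1 : max a c + ω ^ y < x := by
    rw [← Ordinal.add_sub_cancel_of_le hcm, add_assoc]
    conv_rhs => rw [hc]
    exact add_lt_add_right (isPrincipal_add_omega0_opow _ hmx
      ((opow_lt_opow_iff_right one_lt_omega0).2 hlt)) c
  have h2 : a < max a c + ω ^ y :=
    (le_max_left a c).trans_lt ((lt_add_iff_pos_right _).2 (opow_pos _ omega0_pos))
  have := ha ⟨h2, h1.le⟩
  rwa [mem_preimage, logOne_add_opow] at this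

/-- Every neighbourhood of `x` is mapped by `ℓ ^ μ` onto a set containing `[0, ℓ ^ μ x]`. -/
theorem principal_Iic_hyperlog_le_map (μ x : Ordinal.{u}) :
    𝓟 (Set.Iic (hyperlog μ x)) ≤ map (hyperlog μ) (icardNhds μ x) := by
  induction μ using Ordinal.limitRecOn generalizing x with
  | zero => simp [icardNhds_zero, hyperlog_zero]
  | add_one ξ ih =>
    rw [icardNhds_add, hyperlog_add, ← Filter.map_map, Filter.push_pull, icardNhds_one,
      isHyperlogFamily_hyperlog.one]
    -- The inner filter is now `map (hyperlog ξ) (icardNhds ξ x) ⊓ 𝓝 (hyperlog ξ x)`; by induction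
    -- its first factor is absorbed by the second.
    refine (principal_Iic_logOne_le_map _).trans (Filter.map_mono (le_inf ?_ le_rfl))
    exact (le_principal_iff.2 (Iic_mem_nhds_ordinal _)).trans (ih x)
  | limit μ hμ ih =>
    intro U hU
    obtain ⟨ξ, hξ, hUξ⟩ := mem_icardNhds_of_isSuccLimit hμ (mem_map.1 hU)
    rw [mem_principal]
    intro y hy
    have hdec := Ordinal.add_sub_cancel_of_le hξ.le
    rcases (show y ≤ hyperlog μ x from hy).eq_or_lt with rfl | hlt
    · exact pure_le_icardNhds μ x (mem_map.1 hU)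
    rw [← hdec, ← hyperlog_hyperlog_add] at hlt
    -- The neighbourhood comes from some `ξ < μ`. As `ℓ ^ (μ - ξ)` is initial, `y` is its value at
    -- some `w` below `ℓ ^ ξ x`, and `w` lifts by induction.
    obtain ⟨w, hw, hwy⟩ := (isInitialFun_hyperlog _).exists_lt hlt
    have himg := ih ξ hξ x (image_mem_map hUξ)
    obtain ⟨z, hz, rfl⟩ := mem_principal.1 himg (Set.mem_Iic.2 hw.le)
    rw [hyperlog_hyperlog_add, hdec] at hwy
    rw [← hwy]
    exact hz

/-- Openness and continuity of `ℓ ^ μ` in one equality. For `ν ≠ 0` the set `Iic (hyperlog μ x)` is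
a neighbourhood on the right, which is what `principal_Iic_hyperlog_le_map` needs. -/
theorem map_hyperlog_icardNhds (μ : Ordinal.{u}) {ν : Ordinal.{u}} (hν : ν ≠ 0) (x : Ordinal.{u}) :
    map (hyperlog μ) (icardNhds (μ + ν) x) = icardNhds ν (hyperlog μ x) := by
  rw [icardNhds_add, Filter.push_pull]
  refine inf_eq_right.2 (le_trans ?_ (principal_Iic_hyperlog_le_map μ x))
  exact le_principal_iff.2 (icardNhds_le_nhds hν _ (Iic_mem_nhds_ordinal _))

theorem tendsto_hyperlog_add (μ ν x : Ordinal.{u}) :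
    Tendsto (hyperlog μ) (icardNhds (μ + ν) x) (icardNhds ν (hyperlog μ x)) := by
  rw [icardNhds_add]
  exact tendsto_comap.mono_left inf_le_right

/-- If `x = c + ω ^ β`, any `z` in `(c, x]` with last exponent `β` is `c + d + ω ^ β ≥ x`. -/
theorem eventually_eq_of_logOne_eq (x : Ordinal.{u}) :
    ∀ᶠ z in 𝓝 x, logOne z = logOne x → z = x := by
  rcases eq_or_ne x 0 with rfl | hx
  · filter_upwards [Iic_mem_nhds_ordinal 0] with z hz _ using nonpos_iff_eq_zero.1 hz
  obtain ⟨c, hc⟩ := exists_eq_add_opow_logOne hx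
  have hcx : c < x := by
    conv_rhs => rw [hc]
    exact (lt_add_iff_pos_right _).2 (opow_pos _ omega0_pos)
  filter_upwards [Iic_mem_nhds_ordinal x, lt_mem_nhds hcx] with z hz hcz hzx
  refine le_antisymm hz ?_
  have hz0 : z - c ≠ 0 := by rwa [Ne, Ordinal.sub_eq_zero_iff_le, not_le]
  obtain ⟨d, hd⟩ := exists_eq_add_opow_logOne hz0
  have hdz : z = (c + d) + ω ^ logOne (z - c) := by
    rw [add_assoc, ← hd, Ordinal.add_sub_cancel_of_le hcz.le]
  have hlog : logOne (z - c) = logOne x := by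
    rw [← hzx]
    conv_rhs => rw [hdz, logOne_add_opow]
  rw [hc, hdz, hlog, add_assoc]
  gcongr
  exact le_add_self

/-- Discreteness of fibres is stable under composition. At `ω ^ γ` with `γ > 0`, if every `ℓ ^ (ω ^
δ)` fixes `x`, the supremum clause makes the value at `x` larger than all earlier ones. Otherwise `ω
^ δ + ω ^ γ = ω ^ γ` factors through the smaller point `ℓ ^ (ω ^ δ) x`. -/
theorem eventually_eq_of_hyperlog_eq (μ x : Ordinal.{u}) :
    ∀ᶠ z in icardNhds μ x, hyperlog μ z = hyperlog μ x → z = x := by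
  have hadd : ∀ α β x : Ordinal.{u},
      (∀ᶠ z in icardNhds α x, hyperlog α z = hyperlog α x → z = x) →
      (∀ᶠ z in icardNhds β (hyperlog α x),
        hyperlog β z = hyperlog β (hyperlog α x) → z = hyperlog α x) →
      ∀ᶠ z in icardNhds (α + β) x, hyperlog (α + β) z = hyperlog (α + β) x → z = x := by
    intro α β x h1 h2
    filter_upwards [icardNhds_anti le_self_add x h1, (tendsto_hyperlog_add α β x).eventually h2]
      with z hz1 hz2 hz
    rw [← hyperlog_hyperlog_add, ← hyperlog_hyperlog_add] at hz
    exact hz1 (hz2 hz)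
  induction μ using hyper_induction generalizing x with
  | zero => exact Eventually.of_forall fun z => by simp [hyperlog_zero]
  | add α β hα hβ => exact hadd α β x (hα x) (hβ _)
  | opow γ ih =>
    rcases eq_or_ne γ 0 with rfl | hγ
    · rw [opow_zero, icardNhds_one, isHyperlogFamily_hyperlog.one]
      exact eventually_eq_of_logOne_eq x
    induction x using WellFoundedLT.induction with
    | _ x ihx =>
      by_cases hx : ∀ δ < γ, hyperlogPow δ x = x
      · filter_upwards [icardNhds_le_nhds (opow_pos γ omega0_pos).ne' x (Iic_mem_nhds_ordinal x)]
          with z hz hzx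
        refine (show z ≤ x from hz).eq_of_not_lt fun hlt => ?_
        rw [hyperlog_opow_of_fixed hγ hx] at hzx
        have := Ordinal.le_iSup (fun ζ : Set.Iio x => Order.succ (hyperlog (ω ^ γ) ζ.1)) ⟨z, hlt⟩
        rw [← hzx] at this
        exact absurd this (not_le.2 (Order.lt_succ _))
      · push Not at hx
        obtain ⟨δ, hδ, hne⟩ := hx
        have hlt := lt_of_le_of_ne ((isInitialFun_hyperlogPow δ).le_self x) hne
        have hδγ : ω ^ δ < ω ^ γ := (opow_lt_opow_iff_right one_lt_omega0).2 hδ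
        have := hadd (ω ^ δ) (ω ^ γ) x (ih _ hδγ x)
        rw [add_omega0_opow hδγ, hyperlog_opow δ] at this
        exact this (ihx _ hlt)

/-! ### Reductions and composition with hyperlogarithms -/

/-- `f` restricts to a surjective `d`-map from `[0, e ^ μ Θ]` with the topology given by
`icardNhds μ` onto `[0, e Θ]` with the interval topology, and for all `lam < μ` it is locally
`ℓ ^ lam`-determined. -/
structure IsReduction (μ Θ : Ordinal.{u}) (f : Ordinal.{u} → Ordinal.{u}) : Prop where
  le : ∀ x ≤ hyperexp μ Θ, f x ≤ expOne Θ
  surj : ∀ y ≤ expOne Θ, ∃ x ≤ hyperexp μ Θ, f x = y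
  map_nhds : ∀ x ≤ hyperexp μ Θ, map f (icardNhds μ x) = 𝓝 (f x)
  eventually_eq : ∀ x ≤ hyperexp μ Θ, ∀ᶠ z in icardNhds μ x, f z = f x → z = x
  determined : ∀ lam < μ, ∀ x ≤ hyperexp μ Θ, ∃ U ∈ icardNhds lam x, ∀ y ∈ U, ∀ z ∈ U,
    y ≤ hyperexp μ Θ → z ≤ hyperexp μ Θ → hyperlog lam y = hyperlog lam z → f y = f z

theorem isReduction_id (Θ : Ordinal.{u}) : IsReduction 1 Θ id := by
  have h1 : hyperexp 1 Θ = expOne Θ := congrFun isHyperexpFamily_hyperexp.one Θ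
  refine ⟨fun x hx => hx.trans_eq h1, fun y hy => ⟨y, hy.trans_eq h1.symm, rfl⟩,
    fun x _ => ?_, fun x _ => Eventually.of_forall fun z hz => hz, fun lam hlam x _ => ?_⟩
  · rw [map_id, icardNhds_one, id]
  · refine ⟨Set.univ, univ_mem, fun y _ z _ _ _ hyz => ?_⟩
    rwa [Order.lt_one_iff.1 hlam, hyperlog_zero] at hyz

theorem IsReduction.comp_hyperlog {ν Θ : Ordinal.{u}} {f : Ordinal.{u} → Ordinal.{u}}
    (hf : IsReduction ν Θ f) (hν : ν ≠ 0) (μ : Ordinal.{u}) :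
    IsReduction (μ + ν) Θ (f ∘ hyperlog μ) := by
  have hle : ∀ x ≤ hyperexp (μ + ν) Θ, hyperlog μ x ≤ hyperexp ν Θ := fun x hx => by
    rw [hyperexp_add] at hx
    exact hyperlog_le_of_le_hyperexp hx
  refine ⟨fun x hx => hf.le _ (hle x hx), fun y hy => ?_, fun x hx => ?_, fun x hx => ?_,
    fun lam hlam x hx => ?_⟩
  · obtain ⟨w, hw, rfl⟩ := hf.surj y hy
    refine ⟨hyperexp μ w, ?_, ?_⟩
    · rw [hyperexp_add]; exact (isNormal_hyperexp μ).strictMono.monotone hw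
    · rw [Function.comp, hyperlog_hyperexp]
  · rw [← Filter.map_map, map_hyperlog_icardNhds μ hν, hf.map_nhds _ (hle x hx), Function.comp]
  · filter_upwards [icardNhds_anti le_self_add x (eventually_eq_of_hyperlog_eq μ x),
      (tendsto_hyperlog_add μ ν x).eventually (hf.eventually_eq _ (hle x hx))] with z h1 h2 hz
    exact h1 (h2 hz)
  -- For `lam ≤ μ`, `ℓ ^ lam` determines `ℓ ^ μ` globally; for `lam > μ`, the neighbourhood for `lam
  -- - μ` is pulled back.
  · rcases le_or_gt lam μ with h | h
    · exact ⟨Set.univ, univ_mem, fun y _ z _ _ _ hyz => congrArg f (hyperlog_congr h hyz)⟩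
    · have hdec := Ordinal.add_sub_cancel_of_le h.le
      obtain ⟨U, hU, hdet⟩ := hf.determined (lam - μ)
        (by rwa [Ordinal.sub_lt_of_le h.le]) _ (hle x hx)
      refine ⟨hyperlog μ ⁻¹' U, ?_, fun y hy z hz hyE hzE hyz => ?_⟩
      · rw [← hdec]; exact tendsto_hyperlog_add μ _ x hU
      · refine hdet _ hy _ hz (hle y hyE) (hle z hzE) ?_
        rwa [hyperlog_hyperlog_add, hyperlog_hyperlog_add, hdec]

/-! ### Cofinal sequences and the block decomposition of `e Θ` -/

/-- Countability enters only here. For a successor `α` the sequence is eventually constant. -/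
theorem exists_monotone_cofinal {α : Ordinal.{u}} (h : α.card ≤ Cardinal.aleph0) (h0 : α ≠ 0) :
    ∃ σ : ℕ → Ordinal.{u}, Monotone σ ∧ (∀ n, σ n < α) ∧ ∀ ξ < α, ∃ n, ξ ≤ σ n := by
  have : Countable (Set.Iio α) := by
    rw [← Cardinal.mk_le_aleph0_iff, Cardinal.mk_Iio_ordinal]
    exact Cardinal.lift_le_aleph0.2 h
  have : Nonempty (Set.Iio α) := ⟨⟨0, pos_iff_ne_zero.2 h0⟩⟩
  obtain ⟨g, hg⟩ := exists_surjective_nat (Set.Iio α)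
  refine ⟨fun n => (partialSups g n).1, fun m n hmn => (partialSups g).mono hmn,
    fun n => (partialSups g n).2, fun ξ hξ => ?_⟩
  obtain ⟨n, hn⟩ := hg ⟨ξ, hξ⟩
  refine ⟨n, ?_⟩
  have : g n ≤ partialSups g n := le_partialSups g n
  rw [hn] at this
  exact this

theorem map_add_left_nhds {S : Ordinal.{u}} (hS : IsOpen (Set.Ici S)) (v : Ordinal.{u}) :
    map (S + ·) (𝓝 v) = 𝓝 (S + v) := by
  have hmono : StrictMono (S + ·) := fun a b hab => add_lt_add_right hab S
  have hrange : Set.range (S + ·) = Set.Ici S := by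
    ext y
    exact ⟨fun ⟨v, hv⟩ => hv ▸ Set.mem_Ici.2 le_self_add,
      fun hy => ⟨y - S, Ordinal.add_sub_cancel_of_le hy⟩⟩
  have hemb : IsOpenEmbedding (S + ·) :=
    ⟨hmono.isEmbedding_of_ordConnected (by rw [hrange]; exact Set.ordConnected_Ici),
      by rw [hrange]; exact hS⟩
  exact hemb.map_nhds_eq v

/-- The sum of the order types `e (θ m) + 1` of the intervals `[0, e (θ m)]` with `m < n`. -/
def glueSum (θ : ℕ → Ordinal.{u}) : ℕ → Ordinal.{u}
  | 0 => 0
  | n + 1 => glueSum θ n + (expOne (θ n) + 1)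

/-- Each block starts at `0` or at a successor, so translation onto it is an open embedding. -/
theorem isOpen_Ici_glueSum (θ : ℕ → Ordinal.{u}) (n : ℕ) : IsOpen (Set.Ici (glueSum θ n)) := by
  cases n with
  | zero =>
    rw [glueSum, show Set.Ici (0 : Ordinal.{u}) = Set.univ from Set.Ici_bot]
    exact isOpen_univ
  | succ n =>
    rw [glueSum, ← add_assoc, ← Order.succ_eq_add_one, Order.Ici_succ]
    exact isOpen_Ioi

theorem glueSum_mono (θ : ℕ → Ordinal.{u}) : Monotone (glueSum θ) :=
  monotone_nat_of_le_succ fun n => by rw [glueSum]; exact le_self_add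

theorem glueSum_lt {Θ : Ordinal.{u}} {θ : ℕ → Ordinal.{u}} (hθ : ∀ n, θ n < Θ) (n : ℕ) :
    glueSum θ n < expOne Θ := by
  have hΘ : Θ ≠ 0 := (pos_of_gt (hθ 0)).ne'
  rw [expOne_of_ne_zero hΘ]
  have hp := isPrincipal_add_omega0_opow Θ
  induction n with
  | zero => exact opow_pos _ omega0_pos
  | succ n ih =>
    refine hp ih (hp ?_ ?_)
    · exact (expOne_le_opow _).trans_lt ((opow_lt_opow_iff_right one_lt_omega0).2 (hθ n))
    · exact one_lt_omega0.trans_le (left_le_opow _ (pos_iff_ne_zero.2 hΘ))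

/-- An ordinal below `ω ^ Θ` lies below some `ω ^ ξ * k` with `ξ < Θ`, and from some stage on every
block has length at least `ω ^ ξ`. -/
theorem exists_lt_glueSum {Θ : Ordinal.{u}} {θ : ℕ → Ordinal.{u}} (hθ : Monotone θ)
    (hcof : ∀ ξ < Θ, ∃ n, ξ ≤ θ n) (hΘ : Θ ≠ 0) {y : Ordinal.{u}} (hy : y < expOne Θ) :
    ∃ n, y < glueSum θ n := by
  rw [expOne_of_ne_zero hΘ, lt_omega0_opow hΘ] at hy
  obtain ⟨ξ, hξ, k, hk⟩ := hy
  obtain ⟨N, hN⟩ := hcof ξ hξ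
  refine ⟨N + k, hk.trans_le ?_⟩
  clear hk
  induction k with
  | zero => simp
  | succ k ih =>
    rw [← add_assoc, glueSum, Nat.cast_succ, mul_add_one]
    gcongr
    refine le_trans ?_ (opow_le_expOne_add_one _)
    exact opow_le_opow_right omega0_pos (hN.trans (hθ (Nat.le_add_right N k)))

/-! ### Glueing reductions along cofinal sequences -/

/-- The point `x` enters `[0, e ^ ν (θ n)]` under `ℓ ^ (σ n)`. -/
def Enters (ν : Ordinal.{u}) (σ θ : ℕ → Ordinal.{u}) (x : Ordinal.{u}) (n : ℕ) : Prop :=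
  hyperlog (σ n) x ≤ hyperexp ν (θ n)

open Classical in
/-- The function which, on the points `x` that enter `[0, e ^ ν (θ n)]` for the first time at
stage `n`, is `g n ∘ ℓ ^ (σ n)` followed by the translation of `[0, e (θ n)]` onto the `n`-th of
consecutive intervals. The remaining points are mapped to `e Θ`. -/
def glue (ν Θ : Ordinal.{u}) (σ θ : ℕ → Ordinal.{u}) (g : ℕ → Ordinal.{u} → Ordinal.{u})
    (x : Ordinal.{u}) : Ordinal.{u} :=
  if h : ∃ n, Enters ν σ θ x n then
    glueSum θ (Nat.find h) + g (Nat.find h) (hyperlog (σ (Nat.find h)) x)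
  else expOne Θ

section Glue

variable {ν Θ : Ordinal.{u}} {σ θ : ℕ → Ordinal.{u}} {g : ℕ → Ordinal.{u} → Ordinal.{u}}

theorem glue_of_enters {x : Ordinal.{u}} {n : ℕ} (hn : Enters ν σ θ x n)
    (hlt : ∀ m < n, ¬ Enters ν σ θ x m) :
    glue ν Θ σ θ g x = glueSum θ n + g n (hyperlog (σ n) x) := by
  classical
  have h : ∃ n, Enters ν σ θ x n := ⟨n, hn⟩
  have hfind : Nat.find h = n := (Nat.find_eq_iff h).2 ⟨hn, fun m hm => hlt m hm⟩
  rw [glue, dif_pos h, hfind]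

theorem glue_of_not_enters {x : Ordinal.{u}} (h : ∀ n, ¬ Enters ν σ θ x n) :
    glue ν Θ σ θ g x = expOne Θ := by
  rw [glue, dif_neg (not_exists.2 h)]

theorem exists_first_enters {x : Ordinal.{u}} {n : ℕ} (h : Enters ν σ θ x n) :
    ∃ k ≤ n, Enters ν σ θ x k ∧ ∀ m < k, ¬ Enters ν σ θ x m := by
  classical
  exact ⟨Nat.find ⟨n, h⟩, Nat.find_min' _ h, Nat.find_spec ⟨n, h⟩, fun m hm => Nat.find_min _ hm⟩

theorem glue_congr {y z : Ordinal.{u}}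
    (h : ∀ n, (¬ Enters ν σ θ y n ∧ ¬ Enters ν σ θ z n) ∨ hyperlog (σ n) y = hyperlog (σ n) z) :
    glue ν Θ σ θ g y = glue ν Θ σ θ g z := by
  have hiff : ∀ n, Enters ν σ θ y n ↔ Enters ν σ θ z n := fun n => by
    rcases h n with h1 | h1
    · exact iff_of_false h1.1 h1.2
    · rw [Enters, Enters, h1]
  by_cases hy : ∃ n, Enters ν σ θ y n
  · obtain ⟨n, hn⟩ := hy
    obtain ⟨k, -, hk, hlt⟩ := exists_first_enters hn
    rw [glue_of_enters hk hlt, glue_of_enters ((hiff k).1 hk) fun m hm => by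
      rw [← hiff]; exact hlt m hm]
    rcases h k with h1 | h1
    · exact absurd hk h1.1
    · rw [h1]
  · push Not at hy
    rw [glue_of_not_enters hy, glue_of_not_enters fun n => by rw [← hiff]; exact hy n]

theorem eventually_not_enters {lam x : Ordinal.{u}} {m : ℕ} (hm : σ m < lam)
    (hx : ¬ Enters ν σ θ x m) : ∀ᶠ z in icardNhds lam x, ¬ Enters ν σ θ z m := by
  filter_upwards [eventually_lt_hyperlog hm (not_le.1 hx)] with z hz using not_le.2 hz

theorem eventually_enters {lam x : Ordinal.{u}} {m : ℕ} (hm : σ m < lam)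
    (hx : Enters ν σ θ x m) : ∀ᶠ z in icardNhds lam x, Enters ν σ θ z m := by
  filter_upwards [eventually_hyperlog_le hm] with z hz using hz.trans hx

theorem eventually_glue_eq {lam x : Ordinal.{u}} {n : ℕ} (hσ : Monotone σ) (hlam : σ n < lam)
    (hn : Enters ν σ θ x n) (hlt : ∀ m < n, ¬ Enters ν σ θ x m) :
    ∀ᶠ z in icardNhds lam x, hyperlog (σ n) z ≤ hyperexp ν (θ n) ∧
      glue ν Θ σ θ g z = glueSum θ n + g n (hyperlog (σ n) z) := by
  have h2 : ∀ᶠ z in icardNhds lam x, ∀ m ∈ Set.Iio n, ¬ Enters ν σ θ z m :=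
    (eventually_all_finite (Set.finite_Iio n)).2 fun m hm =>
      eventually_not_enters ((hσ (Set.mem_Iio.1 hm).le).trans_lt hlam) (hlt m hm)
  filter_upwards [eventually_enters hlam hn, h2] with z h h'
  exact ⟨h, glue_of_enters h h'⟩

theorem not_enters_hyperexp (hprin : ∀ μ < ν, μ + ν = ν) (hσlt : ∀ n, σ n < ν)
    (hθlt : ∀ n, θ n < Θ) (n : ℕ) : ¬ Enters ν σ θ (hyperexp ν Θ) n := by
  rw [Enters, hyperlog_fixed (hprin _ (hσlt n)), not_le]
  exact (isNormal_hyperexp ν).strictMono (hθlt n)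

/-- Otherwise the eventual value `w` of `ℓ ^ (σ n) x` is fixed by every `ℓ ^ (ω ^ δ)`, as `σ N + ω ^
δ` is still below `ω ^ γ`. Hence `w = e ^ (ω ^ γ) η`, and never entering forces `η ≥ Θ`, against `w
≤ x`. -/
theorem exists_enters {γ x : Ordinal.{u}} (hγ : γ ≠ 0) (hσ : Monotone σ)
    (hσcof : ∀ ξ < ω ^ γ, ∃ n, ξ ≤ σ n) (hσlt : ∀ n, σ n < ω ^ γ)
    (hθ : Monotone θ) (hθcof : ∀ ξ < Θ, ∃ n, ξ ≤ θ n) (hx : x < hyperexp (ω ^ γ) Θ) :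
    ∃ n, Enters (ω ^ γ) σ θ x n := by
  by_contra! hcon
  obtain ⟨N, hN⟩ := WellFoundedLT.antitone_chain_condition (f := fun n => hyperlog (σ n) x)
    fun m n hmn => hyperlog_antitone x (hσ hmn)
  set w := hyperlog (σ N) x with hw
  obtain ⟨η, hη⟩ := mem_range_hyperexp_of_fixed hγ (z := w) fun δ hδ => by
    obtain ⟨m, hm⟩ := hσcof (σ N + ω ^ δ) (isPrincipal_add_omega0_opow γ (hσlt N)
      ((opow_lt_opow_iff_right one_lt_omega0).2 hδ))
    have h1 : w ≤ hyperlog (ω ^ δ) w := by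
      rw [hw, hyperlog_hyperlog_add, ← hw, hN (max m N) (le_max_right _ _)]
      exact hyperlog_antitone x (hm.trans (hσ (le_max_left _ _)))
    have h2 : hyperlog (ω ^ δ) w = w := (hyperlog_le_self _ _).antisymm h1
    conv_lhs => rw [← h2]
    exact hyperexp_hyperlog_le _ _
  have hmono := (isNormal_hyperexp (ω ^ γ)).strictMono
  have hΘη : Θ ≤ η := le_of_forall_lt fun ξ hξ => by
    obtain ⟨n, hn⟩ := hθcof ξ hξ
    have h1 := not_le.1 (hcon (max n N))
    rw [← hN (max n N) (le_max_right _ _), ← hη, hmono.lt_iff_lt] at h1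
    exact (hn.trans (hθ (le_max_left _ _))).trans_lt h1
  have h1 : hyperexp (ω ^ γ) Θ ≤ w := hη ▸ hmono.monotone hΘη
  exact absurd (hx.trans_le h1) (not_lt.2 (hyperlog_le_self _ _))

theorem isReduction_glue (hσs : StrictMono σ) (hσpos : ∀ n, σ n ≠ 0)
    (hσcof : ∀ ξ < ν, ∃ n, ξ ≤ σ n) (hσlt : ∀ n, σ n < ν)
    (hprin : ∀ μ < ν, μ + ν = ν) (hlim : Order.IsSuccLimit ν)
    (hθ : Monotone θ) (hθcof : ∀ ξ < Θ, ∃ n, ξ ≤ θ n) (hθlt : ∀ n, θ n < Θ)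
    (hent : ∀ x < hyperexp ν Θ, ∃ n, Enters ν σ θ x n)
    (hg : ∀ n, IsReduction ν (θ n) (g n)) : IsReduction ν Θ (glue ν Θ σ θ g) := by
  have hσ := hσs.monotone
  have hΘ : Θ ≠ 0 := (pos_of_gt (hθlt 0)).ne'
  have htop := not_enters_hyperexp hprin hσlt hθlt
  have hgtop : glue ν Θ σ θ g (hyperexp ν Θ) = expOne Θ := glue_of_not_enters htop
  have hcases : ∀ x ≤ hyperexp ν Θ, x = hyperexp ν Θ ∨
      ∃ n, Enters ν σ θ x n ∧ ∀ m < n, ¬ Enters ν σ θ x m := by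
    intro x hx
    rcases hx.eq_or_lt with h | h
    · exact Or.inl h
    · obtain ⟨n, hn⟩ := hent x h
      obtain ⟨k, -, hk⟩ := exists_first_enters hn
      exact Or.inr ⟨k, hk⟩
  have hltS : ∀ x n, Enters ν σ θ x n → (∀ m < n, ¬ Enters ν σ θ x m) →
      glue ν Θ σ θ g x < glueSum θ (n + 1) := by
    intro x n hn hlt
    rw [glue_of_enters hn hlt, glueSum]
    exact add_lt_add_right (Order.lt_add_one_iff.2 ((hg n).le _ hn)) _
  have hltE : ∀ x n, Enters ν σ θ x n → (∀ m < n, ¬ Enters ν σ θ x m) →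
      glue ν Θ σ θ g x < expOne Θ := fun x n hn hlt =>
    (hltS x n hn hlt).trans (glueSum_lt hθlt _)
  have hblock : ∀ y < expOne Θ, ∃ n, glueSum θ n ≤ y ∧ y < glueSum θ (n + 1) := by
    intro y hy
    classical
    have hex := exists_lt_glueSum hθ hθcof hΘ hy
    obtain ⟨n, hn⟩ : ∃ n, Nat.find hex = n + 1 := by
      refine Nat.exists_eq_succ_of_ne_zero fun h => ?_
      have := Nat.find_spec hex
      rw [h, glueSum] at this
      exact not_lt_zero this
    exact ⟨n, not_lt.1 (Nat.find_min hex (by omega)), hn ▸ Nat.find_spec hex⟩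
  -- Openness at the top point, which `ℓ ^ (σ n)` fixes: an `I_(σ n)`-neighbourhood of it is mapped
  -- onto all of `[0, e ^ ν Θ]`. Strictness of `σ` makes not entering before stage `n` an open
  -- condition in `I_(σ n)`, so `z` can be chosen to enter first at stage `n`.
  have hlift : ∀ n, ∀ U ∈ icardNhds (σ n) (hyperexp ν Θ), ∀ y, glueSum θ n ≤ y →
      y < glueSum θ (n + 1) → ∃ z ∈ U, z ≤ hyperexp ν Θ ∧ glue ν Θ σ θ g z = y := by
    intro n U hU y h1 h2
    have hv : y - glueSum θ n ≤ expOne (θ n) := by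
      rw [← Order.lt_add_one_iff, Ordinal.sub_lt_of_le h1]
      exact h2
    obtain ⟨w, hw, hgw⟩ := (hg n).surj _ hv
    have hnot : ∀ᶠ z in icardNhds (σ n) (hyperexp ν Θ), ∀ m ∈ Set.Iio n, ¬ Enters ν σ θ z m :=
      (eventually_all_finite (Set.finite_Iio n)).2 fun m hm =>
        eventually_not_enters (hσs (Set.mem_Iio.1 hm)) (htop m)
    have hle := icardNhds_le_nhds (hσpos n) _ (Iic_mem_nhds_ordinal (hyperexp ν Θ))
    have himg := principal_Iic_hyperlog_le_map _ _
      (image_mem_map (inter_mem hU (inter_mem hnot hle)))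
    rw [mem_principal, hyperlog_fixed (hprin _ (hσlt n))] at himg
    have hwΘ : w ∈ Set.Iic (hyperexp ν Θ) :=
      hw.trans ((isNormal_hyperexp ν).strictMono.monotone (hθlt n).le)
    obtain ⟨z, ⟨hzU, hzn, hzE⟩, rfl⟩ := himg hwΘ
    refine ⟨z, hzU, hzE, ?_⟩
    rw [glue_of_enters hw hzn, hgw, Ordinal.add_sub_cancel_of_le h1]
  refine ⟨fun x hx => ?_, fun y hy => ?_, fun x hx => ?_, fun x hx => ?_, fun lam hlam x hx => ?_⟩
  · rcases hcases x hx with rfl | ⟨n, hn, hlt⟩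
    · exact hgtop.le
    · exact (hltE x n hn hlt).le
  · rcases hy.eq_or_lt with rfl | hlt
    · exact ⟨_, le_rfl, hgtop⟩
    · obtain ⟨n, h1, h2⟩ := hblock y hlt
      obtain ⟨z, -, hz⟩ := hlift n Set.univ univ_mem y h1 h2
      exact ⟨z, hz⟩
  · rcases hcases x hx with rfl | ⟨n, hn, hlt⟩
    · rw [hgtop]
      apply le_antisymm
      · refine tendsto_order.2 ⟨fun a ha => ?_, fun a ha => ?_⟩
        · obtain ⟨k, hk⟩ := exists_lt_glueSum hθ hθcof hΘ ha
          have hnot : ∀ᶠ z in icardNhds ν (hyperexp ν Θ), ∀ m ∈ Set.Iio k, ¬ Enters ν σ θ z m :=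
            (eventually_all_finite (Set.finite_Iio k)).2 fun m _ =>
              eventually_not_enters (hσlt m) (htop m)
          filter_upwards [hnot, icardNhds_le_nhds hlim.ne_bot _ (Iic_mem_nhds_ordinal _)]
            with z hz hzE
          rcases hcases z hzE with rfl | ⟨n, hn, hlt⟩
          · rwa [hgtop]
          · rw [glue_of_enters hn hlt]
            have hkn : k ≤ n := not_lt.1 fun h => hz n h hn
            exact hk.trans_le ((glueSum_mono θ hkn).trans le_self_add)
        · filter_upwards [icardNhds_le_nhds hlim.ne_bot _ (Iic_mem_nhds_ordinal _)] with z hzE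
          rcases hcases z hzE with rfl | ⟨n, hn, hlt⟩
          · rwa [hgtop]
          · exact (hltE z n hn hlt).trans ha
      · intro V hV
        -- A neighbourhood of the top already arises at some `ξ < ν`, so its image contains every
        -- block `n` with `σ n ≥ ξ`.
        obtain ⟨ξ, hξ, hVξ⟩ := mem_icardNhds_of_isSuccLimit hlim (mem_map.1 hV)
        obtain ⟨k, hk⟩ := hσcof ξ hξ
        filter_upwards [lt_mem_nhds (glueSum_lt hθlt k), Iic_mem_nhds_ordinal _] with y hky hyE
        rcases (show y ≤ expOne Θ from hyE).eq_or_lt with rfl | hlt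
        · have := pure_le_icardNhds ν _ (mem_map.1 hV)
          rwa [mem_pure, mem_preimage, hgtop] at this
        · obtain ⟨n, h1, h2⟩ := hblock y hlt
          have hkn : k ≤ n := by
            by_contra! h
            exact absurd (hky.trans h2) (not_lt.2 (glueSum_mono θ (Nat.succ_le_of_lt h)))
          obtain ⟨z, hz, -, rfl⟩ := hlift n _ (icardNhds_anti (hk.trans (hσ hkn)) _ hVξ) y h1 h2
          exact hz
    -- Near a point entering at stage `n` the map is a translate of `g n ∘ ℓ ^ (σ n)`, and `σ n + ν
    -- = ν`.
    · have hev := eventually_glue_eq (Θ := Θ) (g := g) hσ (hσlt n) hn hlt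
      rw [Filter.map_congr (hev.mono fun z hz => hz.2), glue_of_enters hn hlt,
        ← map_add_left_nhds (isOpen_Ici_glueSum θ n), ← (hg n).map_nhds _ hn,
        ← map_hyperlog_icardNhds (σ n) hlim.ne_bot, hprin _ (hσlt n), Filter.map_map,
        Filter.map_map]
      rfl
  · rcases hcases x hx with rfl | ⟨n, hn, hlt⟩
    · filter_upwards [icardNhds_le_nhds hlim.ne_bot _ (Iic_mem_nhds_ordinal _)] with z hz hzE
      rcases hcases z hz with rfl | ⟨k, hk, hlt⟩
      · rfl
      · rw [hgtop] at hzE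
        exact absurd hzE (hltE z k hk hlt).ne
    · have hpull := (tendsto_hyperlog_add (σ n) ν x).eventually ((hg n).eventually_eq _ hn)
      rw [hprin _ (hσlt n)] at hpull
      filter_upwards [eventually_glue_eq (Θ := Θ) (g := g) hσ (hσlt n) hn hlt, hpull,
        icardNhds_anti (hσlt n).le x (eventually_eq_of_hyperlog_eq (σ n) x)] with z h1 h2 h3 h4
      rw [h1.2, glue_of_enters hn hlt] at h4
      exact h3 (h2 (add_left_cancel h4))
  -- If `x` enters at a stage with `σ n < lam`, the first such stage is locally constant and `g n`
  -- decides. If not, nearby points also miss these finitely many stages, and all others depend only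
  -- on `ℓ ^ lam`.
  · by_cases hcase : ∃ n, σ n < lam ∧ Enters ν σ θ x n
    · obtain ⟨m, hm, hxm⟩ := hcase
      obtain ⟨n, hnm, hn, hlt⟩ := exists_first_enters hxm
      have hnlam : σ n < lam := (hσ hnm).trans_lt hm
      have hdec := Ordinal.add_sub_cancel_of_le hnlam.le
      obtain ⟨U, hU, hdet⟩ :=
        (hg n).determined (lam - σ n) ((Ordinal.sub_le_self _ _).trans_lt hlam) _ hn
      have hpull := tendsto_hyperlog_add (σ n) (lam - σ n) x hU
      rw [hdec] at hpull
      refine ⟨_, inter_mem (eventually_glue_eq (Θ := Θ) (g := g) hσ hnlam hn hlt) hpull,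
        fun y hy z hz _ _ hyz => ?_⟩
      rw [hy.1.2, hz.1.2]
      congr 1
      refine hdet _ hy.2 _ hz.2 hy.1.1 hz.1.1 ?_
      rwa [hyperlog_hyperlog_add, hyperlog_hyperlog_add, hdec]
    · push Not at hcase
      obtain ⟨M, hM⟩ := hσcof lam hlam
      have hnot : ∀ᶠ z in icardNhds lam x, ∀ m ∈ Set.Iio M, σ m < lam → ¬ Enters ν σ θ z m := by
        refine (eventually_all_finite (Set.finite_Iio M)).2 fun m _ => ?_
        by_cases h : σ m < lam
        · filter_upwards [eventually_not_enters h (hcase m h)] with z hz _ using hz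
        · exact Eventually.of_forall fun z h' => absurd h' h
      refine ⟨_, hnot, fun y hy z hz _ _ hyz => glue_congr fun n => ?_⟩
      by_cases h : σ n < lam
      · have hnM : n < M := by
          by_contra! h'
          exact absurd h (not_lt.2 (hM.trans (hσ h')))
        exact Or.inl ⟨hy n hnM h, hz n hnM h⟩
      · exact Or.inr (hyperlog_congr (not_lt.1 h) hyz)

end Glue

/-! ### Existence of reductions -/

theorem exists_strictMono_cofinal {α : Ordinal.{u}} (h : α.card ≤ Cardinal.aleph0)
    (hα : Order.IsSuccLimit α) : ∃ σ : ℕ → Ordinal.{u}, StrictMono σ ∧ (∀ n, σ n ≠ 0) ∧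
      (∀ n, σ n < α) ∧ ∀ ξ < α, ∃ n, ξ ≤ σ n := by
  obtain ⟨σ, hσ, hlt, hcof⟩ := exists_monotone_cofinal h hα.ne_bot
  have hadd : ∀ ξ < α, ∀ n : ℕ, ξ + n < α := by
    intro ξ hξ n
    induction n with
    | zero => simpa using hξ
    | succ n ih =>
      rw [Nat.cast_succ, ← add_assoc]
      exact hα.add_one_lt ih
  -- Adding `n + 1` makes the sequence strict and nonzero, and stays below a limit.
  refine ⟨fun n => σ n + (n + 1 : ℕ), strictMono_nat_of_lt_succ fun n => ?_, fun n => ?_,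
    fun n => hadd _ (hlt n) _, fun ξ hξ => ?_⟩
  · refine (add_le_add_left (hσ n.le_succ) _).trans_lt (add_lt_add_right ?_ _)
    exact_mod_cast Nat.lt_succ_self (n + 1)
  · simp
  · obtain ⟨n, hn⟩ := hcof ξ hξ
    exact ⟨n, hn.trans le_self_add⟩

theorem hyperexp_apply_zero (μ : Ordinal.{u}) : hyperexp μ 0 = 0 := by
  have h := hyperexp_hyperlog_le μ 0
  rw [nonpos_iff_eq_zero.1 (hyperlog_le_self μ 0)] at h
  exact nonpos_iff_eq_zero.1 h

theorem nhds_zero_ordinal : 𝓝 (0 : Ordinal.{u}) = pure 0 := by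
  refine le_antisymm (le_pure_iff.2 ?_) (pure_le_nhds 0)
  filter_upwards [Iic_mem_nhds_ordinal 0] with z hz using nonpos_iff_eq_zero.1 hz

theorem isReduction_zero {ν : Ordinal.{u}} (hν : ν ≠ 0) : IsReduction ν 0 id := by
  have h0 : ∀ x ≤ hyperexp ν 0, x = 0 := fun x hx => by
    rw [hyperexp_apply_zero] at hx
    exact nonpos_iff_eq_zero.1 hx
  refine ⟨fun x hx => ?_, fun y hy => ?_, fun x hx => ?_, fun x _ => Eventually.of_forall
    fun z hz => hz, fun lam _ x _ => ⟨Set.univ, univ_mem, fun y _ z _ hy hz _ => ?_⟩⟩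
  · rw [h0 x hx, expOne_zero]; exact le_rfl
  · rw [expOne_zero] at hy
    exact ⟨0, bot_le, (nonpos_iff_eq_zero.1 hy).symm⟩
  · rw [h0 x hx, map_id, id]
    refine (icardNhds_le_nhds hν 0).antisymm ?_
    rw [nhds_zero_ordinal]
    exact pure_le_icardNhds ν 0
  · rw [h0 y hy, h0 z hz]

theorem exists_isReduction_opow {γ Θ : Ordinal.{u}}
    (hγc : (ω ^ γ : Ordinal.{u}).card ≤ Cardinal.aleph0)
    (hΘ : Θ.card ≤ Cardinal.aleph0) : ∃ f, IsReduction (ω ^ γ) Θ f := by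
  rcases eq_or_ne γ 0 with rfl | hγ
  · rw [opow_zero]
    exact ⟨id, isReduction_id Θ⟩
  have hlim : Order.IsSuccLimit (ω ^ γ) := isSuccLimit_opow_left isSuccLimit_omega0 hγ
  obtain ⟨σ, hσ, hσpos, hσlt, hσcof⟩ := exists_strictMono_cofinal hγc hlim
  induction Θ using WellFoundedLT.induction with
  | _ Θ ih =>
    rcases eq_or_ne Θ 0 with rfl | hΘ0
    · exact ⟨id, isReduction_zero hlim.ne_bot⟩
    obtain ⟨θ, hθ, hθlt, hθcof⟩ := exists_monotone_cofinal hΘ hΘ0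
    choose g hg using fun n => ih (θ n) (hθlt n) ((card_le_card (hθlt n).le).trans hΘ)
    exact ⟨_, isReduction_glue hσ hσpos hσcof hσlt (fun μ hμ => add_omega0_opow hμ) hlim hθ hθcof hθlt
      (fun x hx => exists_enters hγ hσ.monotone hσcof hσlt hθ hθcof hx) hg⟩

theorem exists_isReduction {μ Θ : Ordinal.{u}} (h0 : μ ≠ 0) (hμ : μ.card ≤ Cardinal.aleph0)
    (hΘ : Θ.card ≤ Cardinal.aleph0) : ∃ f, IsReduction μ Θ f := by
  obtain ⟨α, γ, rfl⟩ := exists_eq_add_opow h0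
  obtain ⟨f, hf⟩ := exists_isReduction_opow ((card_le_card le_add_self).trans hμ) hΘ
  exact ⟨_, hf.comp_hyperlog (opow_pos γ omega0_pos).ne' α⟩

/-! ### From filters back to the Icard topologies -/

/-- The restriction `β ≤ Θ` in the generating sets is harmless, because `ℓ ^ ξ ϑ ≤ ϑ < Θ`. -/
theorem icard_eq_iInf_induced (Θ : Ordinal.{u}) {lam : Ordinal.{u}} (h : lam ≠ 0) :
    icard Θ lam = ⨅ ξ : Set.Iio lam, TopologicalSpace.induced
      (fun ϑ : Set.Iio Θ => hyperlog ξ.1 ϑ.1) inferInstance := by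
  rw [icard, if_neg h]
  apply le_antisymm
  · refine le_iInf fun ξ => ?_
    rw [← continuous_iff_le_induced, OrderTopology.topology_eq_generate_intervals (α := Ordinal.{u})]
    refine continuous_generateFrom_iff.2 ?_
    rintro _ ⟨a, rfl | rfl⟩
    · rcases lt_or_ge a Θ with ha | ha
      · refine TopologicalSpace.isOpen_generateFrom_of_mem (Or.inr
          ⟨ξ.1, ξ.2, Θ, le_rfl, a, ha, ?_⟩)
        ext x
        exact ⟨fun h => ⟨h, (hyperlog_le_self _ _).trans x.2.le⟩, fun h => h.1⟩
      · have : (fun ϑ : Set.Iio Θ => hyperlog ξ.1 ϑ.1) ⁻¹' Set.Ioi a = ∅ := by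
          ext x
          simp only [mem_preimage, mem_Ioi, mem_empty_iff_false, iff_false, not_lt]
          exact (hyperlog_le_self _ _).trans (x.2.le.trans ha)
        rw [this]
        exact @isOpen_empty _ (TopologicalSpace.generateFrom _)
    · have : (fun ϑ : Set.Iio Θ => hyperlog ξ.1 ϑ.1) ⁻¹' Set.Iio a =
          ⋃ b : {b : Ordinal.{u} // b < a ∧ b ≤ Θ}, {x : Set.Iio Θ | hyperlog ξ.1 x.1 ≤ b.1} := by
        ext x
        rw [Set.mem_iUnion]
        exact ⟨fun h => ⟨⟨hyperlog ξ.1 x.1, h, (hyperlog_le_self _ _).trans x.2.le⟩,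
          le_refl (hyperlog ξ.1 x.1)⟩, fun ⟨b, hb⟩ => lt_of_le_of_lt (b := b.1) hb b.2.1⟩
      rw [this]
      refine @isOpen_iUnion _ _ (TopologicalSpace.generateFrom _) _ fun b => ?_
      exact TopologicalSpace.isOpen_generateFrom_of_mem (Or.inl ⟨ξ.1, ξ.2, b.1, b.2.2, rfl⟩)
  · have hIic : ∀ β : Ordinal.{u}, IsOpen (Set.Iic β) := fun β => by
      rw [← Order.Iio_succ]; exact isOpen_Iio
    refine le_generateFrom ?_
    rintro _ (⟨ξ, hξ, β, -, rfl⟩ | ⟨ξ, hξ, β, -, α, -, rfl⟩)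
    · exact iInf_le (fun ξ : Set.Iio lam => TopologicalSpace.induced
        (fun ϑ : Set.Iio Θ => hyperlog ξ.1 ϑ.1) inferInstance) ⟨ξ, hξ⟩ _
        ⟨Set.Iic β, hIic β, rfl⟩
    · exact iInf_le (fun ξ : Set.Iio lam => TopologicalSpace.induced
        (fun ϑ : Set.Iio Θ => hyperlog ξ.1 ϑ.1) inferInstance) ⟨ξ, hξ⟩ _
        ⟨Set.Ioi α ∩ Set.Iic β, isOpen_Ioi.inter (hIic β), rfl⟩

theorem nhds_icard {Θ lam : Ordinal.{u}} (h : lam ≠ 0) (x : Set.Iio Θ) :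
    @nhds _ (icard Θ lam) x = comap Subtype.val (icardNhds lam x.1) := by
  rw [icard_eq_iInf_induced Θ h, nhds_iInf, icardNhds, comap_iInf]
  refine iInf_congr fun ξ => ?_
  rw [nhds_induced, comap_comap]
  rfl

theorem discreteTopology_fiber {X Y : Type*} [TopologicalSpace X] {f : X → Y}
    (h : ∀ x, ∀ᶠ z in 𝓝 x, f z = f x → z = x) (y : Y) : DiscreteTopology (f ⁻¹' {y}) := by
  refine discreteTopology_iff_singleton_mem_nhds.2 fun x => ?_
  rw [nhds_subtype]
  refine ⟨_, h x.1, fun z hz => Subtype.ext (hz ?_)⟩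
  rw [show f z.1 = y from z.2, show f x.1 = y from x.2]

theorem IsReduction.exists_isReductive {Λ Θ : Ordinal.{u}} {f : Ordinal.{u} → Ordinal.{u}}
    (hf : IsReduction (1 + Λ) Θ f) :
    ∃ r : Set.Iio (hyperexp (1 + Λ) Θ + 1) → Set.Iio (expOne Θ + 1),
      IsReductive Λ r ∧ Function.Surjective r := by
  have h1 : 1 + Λ ≠ 0 := by simp
  have hE : ∀ x : Set.Iio (hyperexp (1 + Λ) Θ + 1), x.1 ≤ hyperexp (1 + Λ) Θ := fun x =>
    Order.lt_add_one_iff.1 x.2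
  let r : Set.Iio (hyperexp (1 + Λ) Θ + 1) → Set.Iio (expOne Θ + 1) := fun x =>
    ⟨f x.1, Order.lt_add_one_iff.2 (hf.le x.1 (hE x))⟩
  have hr : Subtype.val ∘ r = f ∘ Subtype.val := rfl
  have hmap : ∀ x, map r (@nhds _ (icard _ (1 + Λ)) x) = @nhds _ (icard _ 1) (r x) := by
    intro x
    have hmem : ∀ {Ξ : Ordinal.{u}} {μ : Ordinal.{u}}, μ ≠ 0 → ∀ x : Set.Iio Ξ,
        Set.range (Subtype.val : Set.Iio Ξ → Ordinal.{u}) ∈ icardNhds μ x.1 := fun hμ x => by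
      rw [Subtype.range_coe]
      exact icardNhds_le_nhds hμ _ (isOpen_Iio.mem_nhds x.2)
    -- Both subspaces are neighbourhoods of their points among all ordinals, so the equality may be
    -- checked there.
    apply Filter.map_injective Subtype.val_injective
    rw [Filter.map_map, hr, ← Filter.map_map, nhds_icard h1, nhds_icard one_ne_zero,
      map_comap_of_mem (hmem h1 x), map_comap_of_mem (hmem one_ne_zero (r x)), icardNhds_one]
    exact hf.map_nhds _ (hE x)
  refine ⟨r, ⟨?_, fun lam hlam => ?_⟩, fun y => ?_⟩
  · let _ := icard (hyperexp (1 + Λ) Θ + 1) (1 + Λ)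
    let _ := icard (expOne Θ + 1) 1
    refine ⟨continuous_iff_continuousAt.2 fun x => (hmap x).le,
      isOpenMap_iff_nhds_le.2 fun x => (hmap x).ge,
      discreteTopology_fiber fun x => ?_⟩
    rw [nhds_icard h1]
    filter_upwards [preimage_mem_comap (hf.eventually_eq _ (hE x))] with z hz hzx
    exact Subtype.ext (hz (congrArg Subtype.val hzx))
  · rcases eq_or_ne lam 0 with rfl | h0
    -- `I_0` is not of the form treated by `nhds_icard`, but `ℓ ^ 0` is the identity, so any
    -- neighbourhood works.
    · refine fun x => ⟨Set.univ, univ_mem, fun y _ z _ hyz => ?_⟩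
      simp only [hyperlog_zero, id] at hyz
      rw [Subtype.ext hyz]
    · intro x
      obtain ⟨U, hU, hdet⟩ := hf.determined lam hlam x.1 (hE x)
      refine ⟨Subtype.val ⁻¹' U, ?_, fun y hy z hz hyz => ?_⟩
      · rw [nhds_icard h0]
        exact preimage_mem_comap hU
      · exact Subtype.ext (hdet _ hy _ hz (hE y) (hE z) hyz)
  · obtain ⟨x, hx, hxy⟩ := hf.surj y.1 (Order.lt_add_one_iff.1 y.2)
    exact ⟨⟨x, Order.lt_add_one_iff.2 hx⟩, Subtype.ext hxy⟩

end Reductive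

end

theorem mainTheorem4 (Θ Λ : Ordinal.{u})
    (hΘ : Θ.card ≤ Cardinal.aleph0) (hΛ : Λ.card ≤ Cardinal.aleph0) :
    ∃ r : Set.Iio (Reductive.hyperexp (1 + Λ) Θ + 1) → Set.Iio (Reductive.expOne Θ + 1),
      Reductive.IsReductive Λ r ∧ Function.Surjective r := by
  have h : (1 + Λ).card ≤ Cardinal.aleph0 := by
    rw [card_add, card_one]
    exact Cardinal.add_le_aleph0.2 ⟨Cardinal.one_le_aleph0, hΛ⟩
  obtain ⟨f, hf⟩ := Reductive.exists_isReduction (by simp) h hΘ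
  exact hf.exists_isReductive
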